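/- **Setting.** Programs are function-free: terms are variables or constants, and an atom has the form $p(loc,t_1,\dots,t_m)$, where $loc$ is the location (a principal) at which it is defined. A clause is $H\leftarrow B_1,\dots,B_m$ ($m\ge 0$). Let $P_1,\dots,P_n$ be finite sets of clauses, the local policies of $n$ distinct principals, and let $P=P_1\cup\dots\cup P_n$ be the global policy. SLD resolution uses the leftmost selection rule; every input clause is a variant of a clause of $P$ that is variable disjoint from the initial goal, from the current goal, and from the input clauses and substitutions of the earlier steps. A computed answer substitution (c.a.s.) of $P\cup\{\leftarrow A\}$ is the composition of the mgu's of an SLD derivation that starts with $\leftarrow A$ and ends with the empty goal. **The algorithm GEM.** Principals exchange messages asynchronously; every message is received exactly once. A request $\langle id,req,\leftarrow A\rangle$, where the location of $A$ is a constant, is sent to the location of $A$; a response $\langle id,Ans,S_{ans},Loops\rangle$ with $S_{ans}\in\{active,\ loop(id'),\ disposed\}$ is sent back to $req$. Identifiers are strings, and $id\sqsubset id'$ ("$id$ is lower than $id'$") means that $id'$ is a proper prefix of $id$. The table of a goal $G=\ \leftarrow A$ consists of a higher request $HR$ (with identifier $id_1$), a set $LR$ of lower requests, a set $AG$ of loop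 identifiers with counters, a set $AS$ of answers, each with the set of the requests to which it has been sent, and an evaluation tree. The tree has root $A\leftarrow A$ with identifier $id_1$; its nodes carry an identifier, a clause and a status $new$, $active$, $loop(ID)$, $answer$ or $disposed$. New nodes have status $new$ and a globally unique identifier that extends $id_1$. The procedures are as follows. * *Process Request*, on $\langle id,req,G\rangle$. If a variant $G'$ of $G$ has a table: when its root is disposed, Send Response to the request (for $G'$) with $disposed$ and $\emptyset$; otherwise, when $id\sqsubset id_1$ for the identifier $id_1$ of its $HR$, add the request to its $LR$ and Send Response with $active$ and $\{id_1\}$; otherwise Create Table for a variant of $G$ that has no table. If no variant of $G$ has a table, Create Table for $G$. * *Create Table*, for $G=\ \leftarrow A$. The new table has the request as its $HR$, empty $LR$, $AG$ and $AS$, and a root with status $new$. For each applicable clause of the local policy, renamed to $H\leftarrow B_1,\dots,B_m$ apart from $A$, with $\theta=mgu(A,H)$, add the child $(H\leftarrow B_1,\dots,B_m)\theta$ of the root. Then Activate Node. * *Activate Node*. If no non-root node is $new$, or $A\in AS$, Generate Response. Otherwise a $new$ root becomes $active$, and the leftmost $new$ non-root node is selected. If its clause is a fact $H$, the node gets status $answer$,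 $H$ is added to $AS$ unless some answer in $AS$ subsumes it, and Activate Node is called again. If its first body atom $B_1$ has no constant location, the whole computation halts (floundering). Otherwise the node becomes $active$ and a request for $\leftarrow B_1$, with the identifier of the node, is sent to the location of $B_1$. * *Send Response*, to a request with a status and a set $Loops$. Send the answers in $AS$ not yet sent to that request and record them as sent. * *Process Response*, for the non-root node $t$, with clause $H\leftarrow B_1,\dots,B_m$, that has the identifier of the response. If the root is disposed, ignore the response. If $S_{ans}=disposed$, dispose $t$, and if $t$ had status $loop(ID)$ dispose also all nodes with a loop status. Otherwise add $Loops$ to the loop status of $t$ (if $t$ has no loop status and $Loops\neq\emptyset$, set it to $loop(Loops)$), add to $AG$ each identifier of $Loops$ not yet there, with counter $0$, and, if $S_{ans}=loop(id_3)$, decrease the counter of $id_3$ by $1$ and set an $active$ root to $loop(\{id_3\})$. Then, for each answer in $Ans$, renamed to $B_1'$ apart from the clause of $t$, with $\theta=mgu(B_1,B_1')$, add the child $(H\leftarrow B_2,\dots,B_m)\theta$ of $t$. Finally, if the root is $active$, or is $loop(ID)$ and all counters of $ID$ are $0$, Activate Node. * *Generate Response*. (i) If no node has a loop status, Terminate.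 (ii) Else, if some answer has not been sent to some request of $LR$, set the counter of $id_1$ to the number of non-root nodes in loop $id_1$, add $id_1$ to the loop status of the root (make it $loop(\{id_1\})$ if it has none), and Send Response with $loop(id_1)$ and $\emptyset$ to all requests of $LR$. (iii) Else, if $id_1$ is the only loop identifier in $AG$, Terminate. (iv) Else let $Loops$ be the set of the identifiers in $AG$ higher than $id_1$, reset their counters to the number of non-root nodes in the respective loop, and Send Response to $HR$ with $Loops$ and with status $loop(id_4)$ if the root status is $loop(ID)$ with some $id_4\in ID$ higher than $id_1$, and with status $active$ otherwise; the root becomes $active$. * *Terminate*. Dispose all non-answer nodes, Send Response with $disposed$ and $\emptyset$ to $HR$ and to all of $LR$, and erase $HR$, $LR$ and $AG$. A run of GEM on $G_1$ starts without tables and with one request for $G_1$, and proceeds by processing messages in any order. An answer generated for a goal $G=\ \leftarrow A$ that has a table is an atom in its set $AS$ or the head of a node with status $answer$ of its tree; a solution of $G$ generated by the algorithm is a substitution $\theta$ such that $A\theta$ is a generated answer. **Theorem (Soundness).** Let $G_1$ be a goal, and let $S$ be the set of tables at the end (or at any other stage) of a run of GEM on $G_1$ with respect to $P=P_1\cup\dots\cup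 P_n$. Let $G_i=\ \leftarrow A_i$ be any goal that has a table in $S$. Then every answer generated for $G_i$ has the form $A_i\theta$, and for every solution $\theta$ of $G_i$ generated by the algorithm there is an SLD derivation of $P\cup\{G_i\}$ with a c.a.s. $\sigma$ such that $A_i\theta$ is a renaming of $A_i\sigma$. -/

import Mathlib

namespace GEM

noncomputable section

/-! ## Function-free logic programs -/

/-- Terms are variables (numbered) or constants. -/
inductive Term (Const : Type*) where
  | var (x : ℕ)
  | const (c : Const)

/-- The set of variables of a term. -/
def Term.vars {Const : Type*} : Term Const → Set ℕ
  | .var x => {x}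
  | .const _ => ∅

/-- Replace every variable `x` by the term `f x`. -/
def Term.bind {Const : Type*} (f : ℕ → Term Const) : Term Const → Term Const
  | .var x => f x
  | .const c => .const c

/-- An atom `p(loc, t₁, …, tₙ)`; the first parameter is the location where it is defined. -/
structure Atom (Const Pred : Type*) where
  pred : Pred
  loc : Term Const
  args : List (Term Const)

/-- A clause `H ← B₁, …, Bₙ`. -/
structure Clause (Const Pred : Type*) where
  head : Atom Const Pred
  body : List (Atom Const Pred)

/-- A substitution moves only finitely many variables. -/
structure Subst (Const : Type*) where
  toFun : ℕ → Term Const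
  finite_support : {x | toFun x ≠ .var x}.Finite

variable {Const Pred : Type*}

/-- The empty substitution. -/
def Subst.empty : Subst Const where
  toFun := .var
  finite_support := by simp

/-- `θ.comp σ` is the composition `θσ`: first `θ`, then `σ`. -/
def Subst.comp (θ σ : Subst Const) : Subst Const where
  toFun x := (θ.toFun x).bind σ.toFun
  finite_support := by
    refine (θ.finite_support.union σ.finite_support).subset ?_
    intro x hx
    by_cases h : θ.toFun x = .var x
    · right
      simpa [h, Term.bind] using hx
    · exact Or.inl h

/-- The variables of a substitution: its domain and the variables of its range. -/
def Subst.vars (θ : Subst Const) : Set ℕ :=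
  {x | θ.toFun x ≠ .var x} ∪ {y | ∃ x, θ.toFun x ≠ .var x ∧ y ∈ (θ.toFun x).vars}

def Atom.vars (A : Atom Const Pred) : Set ℕ :=
  A.loc.vars ∪ {x | ∃ t ∈ A.args, x ∈ t.vars}

/-- The variables of a list of atoms. -/
def atomsVars (L : List (Atom Const Pred)) : Set ℕ :=
  {x | ∃ A ∈ L, x ∈ A.vars}

def Clause.vars (c : Clause Const Pred) : Set ℕ :=
  c.head.vars ∪ atomsVars c.body

def Atom.bind (f : ℕ → Term Const) (A : Atom Const Pred) : Atom Const Pred :=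
  ⟨A.pred, A.loc.bind f, A.args.map (Term.bind f)⟩

def Clause.bind (f : ℕ → Term Const) (c : Clause Const Pred) : Clause Const Pred :=
  ⟨c.head.bind f, c.body.map (Atom.bind f)⟩

/-- Application of a substitution to an atom. -/
def Atom.subst (A : Atom Const Pred) (θ : Subst Const) : Atom Const Pred :=
  A.bind θ.toFun

/-- Application of a substitution to a clause. -/
def Clause.subst (c : Clause Const Pred) (θ : Subst Const) : Clause Const Pred :=
  c.bind θ.toFun

/-- `A'` is a renaming (variant) of `A`. -/
def Atom.Variant (A A' : Atom Const Pred) : Prop :=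
  ∃ ρ : Equiv.Perm ℕ, A' = A.bind (fun x => .var (ρ x))

/-- `c'` is a renaming (variant) of `c`. -/
def Clause.Variant (c c' : Clause Const Pred) : Prop :=
  ∃ ρ : Equiv.Perm ℕ, c' = c.bind (fun x => .var (ρ x))

/-- `θ` unifies `A` and `B`. -/
def IsUnifier (θ : Subst Const) (A B : Atom Const Pred) : Prop :=
  A.subst θ = B.subst θ

/-- `θ` is a most general unifier of `A` and `B`. -/
def IsMgu (θ : Subst Const) (A B : Atom Const Pred) : Prop :=
  IsUnifier θ A B ∧ ∀ τ : Subst Const, IsUnifier τ A B → ∃ γ : Subst Const, τ = θ.comp γ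

/-- `A` subsumes `B`, i.e. `B` is an instance of `A`. -/
def Atom.Subsumes (A B : Atom Const Pred) : Prop :=
  ∃ γ : Subst Const, B = A.subst γ

/-! ## SLD resolution (leftmost selection rule) -/

/-- `G'` is the resolvent of the goal `G` and the input clause `c'` (a variant of a clause of
the program `P`, variable disjoint from `G`) with mgu `θ`; the leftmost atom is selected. -/
def Resolvent (P : Set (Clause Const Pred)) (c' : Clause Const Pred) (θ : Subst Const)
    (G G' : List (Atom Const Pred)) : Prop :=
  (∃ c ∈ P, c.Variant c') ∧ Disjoint c'.vars (atomsVars G) ∧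
    ∃ B Bs, G = B :: Bs ∧ IsMgu θ B c'.head ∧ G' = (c'.body ++ Bs).map (fun C => C.subst θ)

/-- `SLDDerivation P W G θ G'`: there is a finite SLD derivation from `G` to `G'` with
composed substitution `θ = θ₁⋯θₙ`, in which every input clause is variable disjoint from `W`
and from the substitutions and the input clauses of the earlier steps. -/
inductive SLDDerivation (P : Set (Clause Const Pred)) :
    Set ℕ → List (Atom Const Pred) → Subst Const → List (Atom Const Pred) → Prop
  | refl (W : Set ℕ) (G : List (Atom Const Pred)) : SLDDerivation P W G Subst.empty G
  | step {W : Set ℕ} {G G' G'' : List (Atom Const Pred)} {c' : Clause Const Pred}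
      {θ σ : Subst Const} (hres : Resolvent P c' θ G G') (hdisj : Disjoint c'.vars W)
      (hrest : SLDDerivation P (W ∪ c'.vars ∪ θ.vars) G' σ G'') :
      SLDDerivation P W G (θ.comp σ) G''

/-- `σ` is the computed answer substitution of some SLD derivation of `P ∪ {G}`, i.e. one
that starts in `G`, whose input clauses also avoid the variables of `G`, and that ends with
the empty goal. -/
def IsCAS (P : Set (Clause Const Pred)) (G : List (Atom Const Pred)) (σ : Subst Const) : Prop :=
  SLDDerivation P (atomsVars G) G σ []

/-! ## Data structures of GEM -/

/-- Identifiers are sequences of characters. -/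
abbrev Ident := List Char

/-- `id₁ ⊏ id₂`: `id₁` is lower than `id₂`, i.e. `id₂` is a proper prefix of `id₁`. -/
def Lower (id₁ id₂ : Ident) : Prop := id₂ <+: id₁ ∧ id₁ ≠ id₂

/-- A request `⟨id, req, ← goal⟩`. -/
structure Request (Const Pred : Type*) where
  id : Ident
  req : Const
  goal : Atom Const Pred

/-- Status of a response. -/
inductive RespStatus where
  | active
  | loop (id : Ident)
  | disposed

/-- A response `⟨id, Ans, S_ans, Loops⟩`. -/
structure Response (Const Pred : Type*) where
  id : Ident
  ans : List (Atom Const Pred)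
  status : RespStatus
  loops : Set Ident

/-- A message in transit. A request is addressed to the location of its goal, a response to
the principal `dest`. -/
inductive Message (Const Pred : Type*) where
  | request (r : Request Const Pred)
  | response (dest : Const) (r : Response Const Pred)

/-- Status of a node. -/
inductive NodeStatus where
  | new
  | active
  | loop (ids : Set Ident)
  | answer
  | disposed

/-- The status is `loop(ID)` for some `ID`. -/
def NodeStatus.IsLoop (S : NodeStatus) : Prop := ∃ ids, S = .loop ids

/-- The status is `loop(ID)` with `i ∈ ID`. -/
def NodeStatus.InLoop (i : Ident) (S : NodeStatus) : Prop := ∃ ids, S = .loop ids ∧ i ∈ ids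

/-- A node `⟨id, clause, status⟩` of an evaluation tree, with its position in the tree: the
list of the indices (from the left) of the branches that lead to it from the root. -/
structure Node (Const Pred : Type*) where
  id : Ident
  clause : Clause Const Pred
  status : NodeStatus
  pos : List ℕ

/-- The table `⟨HR, LR, ActiveGoals, AnsSet, Tree⟩` of a goal. The tree is given by its root
and the list of its other nodes; `active` maps the identifiers of the loops in `ActiveGoals` to
their counters; `ans` pairs each answer with the identifiers of the requests to which it was
sent; `hr = none` is the value `null`. -/
structure Table (Const Pred : Type*) where
  hr : Option (Request Const Pred)
  lr : List (Request Const Pred)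
  active : Ident → Option ℤ
  ans : List (Atom Const Pred × Set Ident)
  root : Node Const Pred
  nodes : List (Node Const Pred)

/-- `Tables G` is the table of `G`, if there is one. It is kept at the location of `G`. -/
abbrev Tables (Const Pred : Type*) := Atom Const Pred → Option (Table Const Pred)

/-- A global state: the tables, the messages in transit, and a flag that says whether the
computation was halted by floundering. -/
structure State (Const Pred : Type*) where
  tables : Tables Const Pred
  net : Multiset (Message Const Pred)
  halted : Bool

/-- The identifiers of the nodes of all evaluation trees. -/
def usedIds (tab : Tables Const Pred) : Set Ident :=
  {i | ∃ G T, tab G = some T ∧ (i = T.root.id ∨ ∃ t ∈ T.nodes, i = t.id)}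

section Procedures

open scoped Classical

/-! ## Auxiliary operations on tables -/

def Table.setRoot (T : Table Const Pred) (S : NodeStatus) : Table Const Pred :=
  { T with root := { T.root with status := S } }

/-- Change the status of the (non-root) node with identifier `i`. -/
def Table.setNode (T : Table Const Pred) (i : Ident) (S : NodeStatus) : Table Const Pred :=
  { T with nodes := T.nodes.map fun t => if t.id = i then { t with status := S } else t }

/-- Dispose the nodes (including the root) whose status satisfies `p`. -/
def Table.disposeIf (T : Table Const Pred) (p : NodeStatus → Prop) : Table Const Pred :=
  let d : Node Const Pred → Node Const Pred :=
    fun t => if p t.status then { t with status := .disposed } else t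
  { T with root := d T.root, nodes := T.nodes.map d }

/-- The number of subgoals in the tree that are involved in loop `i`. -/
def Table.loopCount (T : Table Const Pred) (i : Ident) : ℤ :=
  (T.nodes.countP fun t => decide (t.status.InLoop i) : ℕ)

/-- Set the counters of the loops in `L` to the number of subgoals involved in them. -/
def Table.resetCounters (T : Table Const Pred) (L : Set Ident) : Table Const Pred :=
  { T with active := fun i => if i ∈ L then some (T.loopCount i) else T.active i }

/-- `t` is the leftmost non-root node with status `new`. -/
def Table.IsLeftmostNew (T : Table Const Pred) (t : Node Const Pred) : Prop :=
  t ∈ T.nodes ∧ t.status = .new ∧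
    ∀ u ∈ T.nodes, u.status = .new → u = t ∨ List.Lex (· < ·) t.pos u.pos

/-- `subs` are new child nodes, one for each clause of `cls`, of the node at position `pos`,
to the right of its `k` existing children; their identifiers extend the identifier `rootId`
by unique sequences of characters. -/
def NewChildren (used : Set Ident) (rootId : Ident) (pos : List ℕ) (k : ℕ)
    (cls : List (Clause Const Pred)) (subs : List (Node Const Pred)) : Prop :=
  subs.map Node.clause = cls ∧
  subs.map Node.pos = (List.range cls.length).map (fun j => pos ++ [k + j]) ∧
  (subs.map Node.id).Nodup ∧
  ∀ t ∈ subs, t.status = .new ∧ t.id ∉ used ∧ ∃ s : List Char, s ≠ [] ∧ t.id = rootId ++ s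

/-! ## The procedures -/

/-- Send Response: the answers of the table that have not yet been sent to request `r` are
sent to its requester. -/
def sendResponse (r : Request Const Pred) (S : RespStatus) (L : Set Ident)
    (T : Table Const Pred) : Table Const Pred × Message Const Pred :=
  ({ T with ans := T.ans.map fun p => (p.1, p.2 ∪ {r.id}) },
   .response r.req
    ⟨r.id, (T.ans.filter fun p => decide (r.id ∉ p.2)).map Prod.fst, S, L⟩)

/-- Send Response for each of the given requests. -/
def sendAll (S : RespStatus) (L : Set Ident) :
    List (Request Const Pred) → Table Const Pred →
      Table Const Pred × Multiset (Message Const Pred)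
  | [], T => (T, 0)
  | r :: rs, T =>
    let x := sendResponse r S L T
    let y := sendAll S L rs x.1
    (y.1, x.2 ::ₘ y.2)

/-- Terminate. -/
def terminate (T : Table Const Pred) : Table Const Pred × Multiset (Message Const Pred) :=
  let x := sendAll .disposed ∅ (T.hr.toList ++ T.lr) (T.disposeIf (· ≠ .answer))
  ({ x.1 with hr := none, lr := [], active := fun _ => none }, x.2)

/-- The goal is the coordinator of a loop and has an answer that has not been sent to some
lower request. -/
def Table.HasUnsentLoopAnswer (T : Table Const Pred) : Prop :=
  ∃ r ∈ T.lr, ∃ p ∈ T.ans, r.id ∉ p.2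

/-- The goal is the leader of its SCC: the only loop identifier in `ActiveGoals` is the
identifier of the higher request. -/
def Table.IsLeader (T : Table Const Pred) : Prop :=
  ∀ i, T.active i ≠ none ↔ i = T.root.id

/-- Some node of the tree has status `loop(ID)`. -/
def Table.InSomeLoop (T : Table Const Pred) : Prop :=
  T.root.status.IsLoop ∨ ∃ t ∈ T.nodes, t.status.IsLoop

/-- The loops in `ActiveGoals` that are higher than the goal. -/
def Table.higherLoops (T : Table Const Pred) : Set Ident :=
  {i | T.active i ≠ none ∧ Lower T.root.id i}

/-- The root status at the start of a new iteration of the loop the goal coordinates. -/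
def Table.coordinatorStatus (T : Table Const Pred) : NodeStatus :=
  match T.root.status with
  | .loop ids => .loop (ids ∪ {T.root.id})
  | _ => .loop {T.root.id}

/-- Generate Response: `GenerateResponse T T' ms` means that from table `T` it may end with
table `T'` after having sent the messages `ms`. -/
inductive GenerateResponse (T : Table Const Pred) :
    Table Const Pred → Multiset (Message Const Pred) → Prop
  | noLoop (h : ¬ T.InSomeLoop) :
      GenerateResponse T (terminate T).1 (terminate T).2
  | coordinator (h : T.InSomeLoop) (hc : T.HasUnsentLoopAnswer)
      (x : Table Const Pred × Multiset (Message Const Pred))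
      (hx : x = sendAll (.loop T.root.id) ∅ T.lr
        ((T.resetCounters {T.root.id}).setRoot T.coordinatorStatus)) :
      GenerateResponse T x.1 x.2
  | leader (h : T.InSomeLoop) (hc : ¬ T.HasUnsentLoopAnswer) (hl : T.IsLeader) :
      GenerateResponse T (terminate T).1 (terminate T).2
  | inLoop (h : T.InSomeLoop) (hc : ¬ T.HasUnsentLoopAnswer) (hl : ¬ T.IsLeader)
      (hr : Request Const Pred) (hhr : T.hr = some hr)
      (i : Ident) (hi : T.root.status.InLoop i ∧ Lower T.root.id i)
      (x : Table Const Pred × Message Const Pred)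
      (hx : x = sendResponse hr (.loop i) T.higherLoops (T.resetCounters T.higherLoops)) :
      GenerateResponse T (x.1.setRoot .active) {x.2}
  | active (h : T.InSomeLoop) (hc : ¬ T.HasUnsentLoopAnswer) (hl : ¬ T.IsLeader)
      (hr : Request Const Pred) (hhr : T.hr = some hr)
      (hi : ¬ ∃ i, T.root.status.InLoop i ∧ Lower T.root.id i)
      (x : Table Const Pred × Message Const Pred)
      (hx : x = sendResponse hr .active T.higherLoops (T.resetCounters T.higherLoops)) :
      GenerateResponse T (x.1.setRoot .active) {x.2}

/-- There is nothing to activate: no non-root node is `new`, or the goal itself is among its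
answers. -/
def Table.NothingToActivate (A : Atom Const Pred) (T : Table Const Pred) : Prop :=
  (¬ ∃ t ∈ T.nodes, t.status = .new) ∨ ∃ p ∈ T.ans, p.1 = A

/-- If the root has status `new`, it becomes `active`. -/
def Table.startRoot (T : Table Const Pred) : Table Const Pred :=
  if T.root.status = .new then T.setRoot .active else T

/-- Add an answer to the answer set unless it is subsumed by an answer already there. -/
def Table.addAnswer (T : Table Const Pred) (H : Atom Const Pred) : Table Const Pred :=
  if ∃ p ∈ T.ans, p.1.Subsumes H then T else { T with ans := T.ans ++ [(H, ∅)] }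

/-- Activate Node, for the goal `← A` at principal `a`: `ActivateNode a A T T' ms h` means
that from table `T` it may end with table `T'` after having sent the messages `ms`; `h` says
whether the computation was halted. -/
inductive ActivateNode (a : Const) (A : Atom Const Pred) :
    Table Const Pred → Table Const Pred → Multiset (Message Const Pred) → Bool → Prop
  | generate {T T' : Table Const Pred} {ms : Multiset (Message Const Pred)}
      (h : T.NothingToActivate A) (hgen : GenerateResponse T T' ms) :
      ActivateNode a A T T' ms false
  | fact {T T' : Table Const Pred} {ms : Multiset (Message Const Pred)} {b : Bool}
      (h : ¬ T.NothingToActivate A) (t : Node Const Pred) (ht : T.IsLeftmostNew t)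
      (hbody : t.clause.body = [])
      (hrec : ActivateNode a A
        ((T.startRoot.setNode t.id .answer).addAnswer t.clause.head) T' ms b) :
      ActivateNode a A T T' ms b
  | flounder {T : Table Const Pred}
      (h : ¬ T.NothingToActivate A) (t : Node Const Pred) (ht : T.IsLeftmostNew t)
      (B : Atom Const Pred) (Bs : List (Atom Const Pred)) (hbody : t.clause.body = B :: Bs)
      (hloc : ¬ ∃ c, B.loc = .const c) :
      ActivateNode a A T T.startRoot 0 true
  | request {T : Table Const Pred}
      (h : ¬ T.NothingToActivate A) (t : Node Const Pred) (ht : T.IsLeftmostNew t)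
      (B : Atom Const Pred) (Bs : List (Atom Const Pred)) (hbody : t.clause.body = B :: Bs)
      (hloc : ∃ c, B.loc = .const c) :
      ActivateNode a A T (T.startRoot.setNode t.id .active) {.request ⟨t.id, a, B⟩} false

/-- The clause `c` is applicable to the goal `← A`. -/
def Applicable (A : Atom Const Pred) (c : Clause Const Pred) : Prop :=
  ∃ c', c.Variant c' ∧ Disjoint c'.vars A.vars ∧ ∃ θ : Subst Const, IsUnifier θ A c'.head

/-- `d` is obtained from `c` by renaming it apart from `A` and applying an mgu of `A` and its
head. -/
def ClauseStep (A : Atom Const Pred) (c d : Clause Const Pred) : Prop :=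
  ∃ c', c.Variant c' ∧ Disjoint c'.vars A.vars ∧
    ∃ θ : Subst Const, IsMgu θ A c'.head ∧ d = c'.subst θ

/-- The initial contents of a new table for the request `r`, when `pol` is the local policy. -/
def InitTable (pol : Set (Clause Const Pred)) (used : Set Ident) (r : Request Const Pred)
    (T : Table Const Pred) : Prop :=
  T.hr = some r ∧ T.lr = [] ∧ T.active = (fun _ => none) ∧ T.ans = [] ∧
  T.root = ⟨r.id, ⟨r.goal, [r.goal]⟩, .new, []⟩ ∧
  ∃ cs ds : List (Clause Const Pred),
    cs.Nodup ∧ (∀ c, c ∈ cs ↔ c ∈ pol ∧ Applicable r.goal c) ∧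
    List.Forall₂ (ClauseStep r.goal) cs ds ∧
    NewChildren (used ∪ {r.id}) r.id [] 0 ds T.nodes

/-- Create Table, at principal `a`. -/
def CreateTable (pol : Set (Clause Const Pred)) (used : Set Ident) (a : Const)
    (r : Request Const Pred) (T' : Table Const Pred) (ms : Multiset (Message Const Pred))
    (h : Bool) : Prop :=
  ∃ T, InitTable pol used r T ∧ ActivateNode a r.goal T T' ms h

/-- Process Request, at principal `a` with local policy `pol`: it changes the table of `G`
to `T'`, sends the messages `ms`, and `h` says whether the computation was halted. -/
inductive ProcessRequest (pol : Set (Clause Const Pred)) (tab : Tables Const Pred) (a : Const)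
    (r : Request Const Pred) :
    Atom Const Pred → Table Const Pred → Multiset (Message Const Pred) → Bool → Prop
  | disposed {G' : Atom Const Pred} {T : Table Const Pred}
      (hT : tab G' = some T) (hvar : r.goal.Variant G') (hS : T.root.status = .disposed)
      (x : Table Const Pred × Message Const Pred)
      (hx : x = sendResponse { r with goal := G' } .disposed ∅ T) :
      ProcessRequest pol tab a r G' x.1 {x.2} false
  | lower {G' : Atom Const Pred} {T : Table Const Pred}
      (hT : tab G' = some T) (hvar : r.goal.Variant G') (hS : T.root.status ≠ .disposed)
      (r₁ : Request Const Pred) (hr₁ : T.hr = some r₁) (hlow : Lower r.id r₁.id)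
      (x : Table Const Pred × Message Const Pred)
      (hx : x = sendResponse { r with goal := G' } .active {r₁.id}
        { T with lr := T.lr ++ [{ r with goal := G' }] }) :
      ProcessRequest pol tab a r G' x.1 {x.2} false
  | side {G' G'' : Atom Const Pred} {T T' : Table Const Pred}
      {ms : Multiset (Message Const Pred)} {h : Bool}
      (hT : tab G' = some T) (hvar : r.goal.Variant G') (hS : T.root.status ≠ .disposed)
      (r₁ : Request Const Pred) (hr₁ : T.hr = some r₁) (hlow : ¬ Lower r.id r₁.id)
      (hvar' : r.goal.Variant G'') (hG'' : tab G'' = none)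
      (hc : CreateTable pol (usedIds tab) a { r with goal := G'' } T' ms h) :
      ProcessRequest pol tab a r G'' T' ms h
  | fresh {T' : Table Const Pred} {ms : Multiset (Message Const Pred)} {h : Bool}
      (hnone : ∀ G', r.goal.Variant G' → tab G' = none)
      (hc : CreateTable pol (usedIds tab) a r T' ms h) :
      ProcessRequest pol tab a r r.goal T' ms h

/-- The first part of Process Response: the status of the node `t` to which the response
refers, the active goals and the status of the root are updated. -/
def updateStatus (r : Response Const Pred) (t : Node Const Pred) (T : Table Const Pred) :
    Table Const Pred :=
  match r.status with
  | .disposed =>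
    (if t.status.IsLoop then T.disposeIf NodeStatus.IsLoop else T).setNode t.id .disposed
  | s =>
    let T₁ : Table Const Pred :=
      match t.status with
      | .loop ids => T.setNode t.id (.loop (ids ∪ r.loops))
      | _ => if r.loops ≠ ∅ then T.setNode t.id (.loop r.loops) else T
    let T₂ : Table Const Pred :=
      { T₁ with active := fun i =>
          if i ∈ r.loops ∧ T₁.active i = none then some 0 else T₁.active i }
    match s with
    | .loop i =>
      let T₃ : Table Const Pred :=
        { T₂ with active := fun j => if j = i then (T₂.active j).map (· - 1) else T₂.active j }
      if T₃.root.status = .active then T₃.setRoot (.loop {i}) else T₃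
    | _ => T₂

/-- `d` is the clause obtained from `H ← B₁, …, Bₙ` and the answer `ans` of `← B₁`: it is
`(H ← B₂, …, Bₙ)θ` where `θ` is an mgu of `B₁` and a renaming of `ans` that is variable disjoint
from the clause. -/
def AnswerStep (c : Clause Const Pred) (ans : Atom Const Pred) (d : Clause Const Pred) : Prop :=
  ∃ B Bs ans', c.body = B :: Bs ∧ ans.Variant ans' ∧ Disjoint ans'.vars c.vars ∧
    ∃ θ : Subst Const, IsMgu θ B ans' ∧ d = (Clause.mk c.head Bs).subst θ

/-- The second part of Process Response: a subnode of `t` is added for each answer. -/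
def AddAnswers (used : Set Ident) (r : Response Const Pred) (t : Node Const Pred)
    (T T' : Table Const Pred) : Prop :=
  ∃ (as : List (Atom Const Pred)) (ds : List (Clause Const Pred)) (subs : List (Node Const Pred)),
    as.Perm r.ans ∧ List.Forall₂ (AnswerStep t.clause) as ds ∧
    NewChildren used T.root.id t.pos (T.nodes.countP fun u => decide (u.pos.dropLast = t.pos))
      ds subs ∧
    T' = { T with nodes := T.nodes ++ subs }

/-- The evaluation may go on: the principal is not waiting for further responses. -/
def Table.CanResume (T : Table Const Pred) : Prop :=
  T.root.status = .active ∨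
    ∃ ids, T.root.status = .loop ids ∧ ∀ i ∈ ids, T.active i = some 0

/-- Process Response, at principal `a`, for a response `r` that refers to the node `t` in the
evaluation tree of the goal `← A` with table `T`. -/
inductive ProcessResponse (used : Set Ident) (a : Const) (A : Atom Const Pred)
    (r : Response Const Pred) (t : Node Const Pred) (T : Table Const Pred) :
    Table Const Pred → Multiset (Message Const Pred) → Bool → Prop
  | ignore (hS : T.root.status = .disposed) : ProcessResponse used a A r t T T 0 false
  | wait {T₁ : Table Const Pred} (hS : T.root.status ≠ .disposed)
      (hadd : AddAnswers used r t (updateStatus r t T) T₁) (hres : ¬ T₁.CanResume) :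
      ProcessResponse used a A r t T T₁ 0 false
  | resume {T₁ T' : Table Const Pred} {ms : Multiset (Message Const Pred)} {h : Bool}
      (hS : T.root.status ≠ .disposed)
      (hadd : AddAnswers used r t (updateStatus r t T) T₁) (hres : T₁.CanResume)
      (hact : ActivateNode a A T₁ T' ms h) :
      ProcessResponse used a A r t T T' ms h

/-! ## Runs -/

/-- The local policy of the principal at location `a`. -/
def localPolicy {n : ℕ} (principal : Fin n ↪ Const) (P : Fin n → Finset (Clause Const Pred))
    (a : Const) : Set (Clause Const Pred) :=
  {c | ∃ i, principal i = a ∧ c ∈ P i}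

/-- The global policy `P₁ ∪ … ∪ Pₙ`. -/
def globalPolicy {n : ℕ} (P : Fin n → Finset (Clause Const Pred)) : Set (Clause Const Pred) :=
  {c | ∃ i, c ∈ P i}

/-- One step of the distributed computation: a message in transit is received and processed.
A response that refers to no node of a tree (the one to the initial request) is just
received. -/
inductive Step {n : ℕ} (principal : Fin n ↪ Const) (P : Fin n → Finset (Clause Const Pred)) :
    State Const Pred → State Const Pred → Prop
  | request {s : State Const Pred} {net : Multiset (Message Const Pred)}
      {r : Request Const Pred} {a : Const} {G : Atom Const Pred} {T' : Table Const Pred}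
      {ms : Multiset (Message Const Pred)} {h : Bool}
      (hs : s.halted = false) (hnet : s.net = .request r ::ₘ net)
      (hloc : r.goal.loc = .const a)
      (hproc : ProcessRequest (localPolicy principal P a) s.tables a r G T' ms h) :
      Step principal P s ⟨Function.update s.tables G (some T'), ms + net, h⟩
  | response {s : State Const Pred} {net : Multiset (Message Const Pred)} {a : Const}
      {r : Response Const Pred} {G : Atom Const Pred} {T T' : Table Const Pred}
      {t : Node Const Pred} {ms : Multiset (Message Const Pred)} {h : Bool}
      (hs : s.halted = false) (hnet : s.net = .response a r ::ₘ net)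
      (hloc : G.loc = .const a) (hT : s.tables G = some T) (ht : t ∈ T.nodes) (hid : t.id = r.id)
      (hproc : ProcessResponse (usedIds s.tables) a G r t T T' ms h) :
      Step principal P s ⟨Function.update s.tables G (some T'), ms + net, h⟩
  | returned {s : State Const Pred} {net : Multiset (Message Const Pred)} {a : Const}
      {r : Response Const Pred}
      (hs : s.halted = false) (hnet : s.net = .response a r ::ₘ net)
      (hno : ¬ ∃ G T t, G.loc = .const a ∧ s.tables G = some T ∧ t ∈ T.nodes ∧ t.id = r.id) :
      Step principal P s { s with net := net }

end Procedures

/-- The initial state: no tables, and the initial request in transit. -/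
def initState (r : Request Const Pred) : State Const Pred :=
  ⟨fun _ => none, {.request r}, false⟩

/-- `s` is reached at some stage of a run of GEM on the initial request `r`; in particular this
holds for the state in which the run ends, normally or by floundering. -/
def Reached {n : ℕ} (principal : Fin n ↪ Const) (P : Fin n → Finset (Clause Const Pred))
    (r : Request Const Pred) (s : State Const Pred) : Prop :=
  Relation.ReflTransGen (Step principal P) (initState r) s

/-- `H` is an answer generated for the goal of the table: it is in the answer set, or it is the
head of an answer node of the tree. -/
def Table.HasAnswer (T : Table Const Pred) (H : Atom Const Pred) : Prop :=
  (∃ p ∈ T.ans, p.1 = H) ∨ ∃ t ∈ T.nodes, t.status = .answer ∧ t.clause.head = H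

/-- The solutions of the goal `← G` generated in its table. -/
def solutions (G : Atom Const Pred) (T : Table Const Pred) : Set (Subst Const) :=
  {θ | T.HasAnswer (G.subst θ)}

end

end GEM

namespace GEM

variable {Const Pred : Type*}

/-! ## Substitution -/

/-! A clause is represented by the set `insts` of all its instances. Renamings leave this set
unchanged (`Clause.Variant.insts_eq`), and no trace is left of which mgu was chosen: resolving two
variable-disjoint clauses on the first body atom becomes the operation `cut` on instance sets
(`insts_resolvent`). `cut` is associative as long as the middle clauses have nonempty bodies
(`cut_assoc`), and `B ← B` is a right unit.

`Derivable P A` collects the sets reached from `A ← A` by cuts with program clauses, that is, the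
leftmost SLD resultants of `← A`. GEM resolves the first body atom `B` of a node with a finished
answer to `← B`; by associativity the whole derivation of that answer can be spliced into the
derivation of the node (`Derivable.cut`). Hence every clause in an evaluation tree is derivable for
the goal of its table. Conversely, a nonempty derivable set comes from a genuine SLD derivation,
because fresh variants exist (`Derivable.exists_sldDerivation`); for a fact this derivation is a
refutation, and two atoms with the same instances are variants.

The rest is an invariant of runs. Messages and nodes are linked only by identifiers, so a registry
`N` of pairs (identifier, clause), functional in the identifier, and a set `U` of identifiers in use
are carried along. `Serves` says that the goal of a request has the same instances as the first body
atom of the node that is waiting for it. Roots are not registered, since a root shares its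
identifier with the requesting node. Freshness of new identifiers preserves all of this
(`Consistent.step`). Statuses, counters and loops play no role, except that answer nodes must carry
facts. -/

theorem Term.bind_bind (f g : ℕ → Term Const) (t : Term Const) :
    (t.bind f).bind g = t.bind (fun x => (f x).bind g) := by
  cases t <;> rfl

theorem Term.bind_var (t : Term Const) : t.bind .var = t := by
  cases t <;> rfl

theorem Term.bind_eq_bind_iff {f g : ℕ → Term Const} {t : Term Const} :
    t.bind f = t.bind g ↔ ∀ x ∈ t.vars, f x = g x := by
  cases t <;> simp [Term.bind, Term.vars]

theorem Term.finite_vars (t : Term Const) : t.vars.Finite := by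
  cases t <;> simp [Term.vars]

theorem Atom.bind_bind (f g : ℕ → Term Const) (A : Atom Const Pred) :
    (A.bind f).bind g = A.bind (fun x => (f x).bind g) := by
  simp [Atom.bind, Term.bind_bind, Function.comp_def]

theorem Atom.bind_var (A : Atom Const Pred) : A.bind .var = A := by
  obtain ⟨p, l, as⟩ := A
  simp only [Atom.bind, Term.bind_var, Atom.mk.injEq, true_and]
  simpa using List.map_congr_left (fun t (_ : t ∈ as) => Term.bind_var t)

theorem Atom.bind_eq_bind_iff {f g : ℕ → Term Const} {A : Atom Const Pred} :
    A.bind f = A.bind g ↔ ∀ x ∈ A.vars, f x = g x := by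
  simp only [Atom.bind, Atom.mk.injEq, true_and, Term.bind_eq_bind_iff, List.map_inj_left,
    Atom.vars, Set.mem_union, Set.mem_ofPred_eq]
  grind

theorem Atom.finite_vars (A : Atom Const Pred) : A.vars.Finite := by
  refine A.loc.finite_vars.union ?_
  have : {x | ∃ t ∈ A.args, x ∈ t.vars} = ⋃ t ∈ {t | t ∈ A.args}, t.vars := by ext; simp
  rw [this]
  exact (List.finite_toSet _).biUnion fun t _ => t.finite_vars

theorem finite_atomsVars (L : List (Atom Const Pred)) : (atomsVars L).Finite := by
  have : atomsVars L = ⋃ A ∈ {A | A ∈ L}, A.vars := by ext; simp [atomsVars]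
  rw [this]
  exact (List.finite_toSet _).biUnion fun A _ => A.finite_vars

theorem Clause.finite_vars (c : Clause Const Pred) : c.vars.Finite :=
  c.head.finite_vars.union (finite_atomsVars _)

theorem Subst.finite_vars (θ : Subst Const) : θ.vars.Finite := by
  refine θ.finite_support.union ?_
  have : {y | ∃ x, θ.toFun x ≠ .var x ∧ y ∈ (θ.toFun x).vars} =
      ⋃ x ∈ {x | θ.toFun x ≠ .var x}, (θ.toFun x).vars := by ext; simp
  rw [this]
  exact θ.finite_support.biUnion fun x _ => Term.finite_vars _

theorem Clause.bind_bind (f g : ℕ → Term Const) (c : Clause Const Pred) :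
    (c.bind f).bind g = c.bind (fun x => (f x).bind g) := by
  simp [Clause.bind, Atom.bind_bind, Function.comp_def]

theorem Clause.bind_eq_bind_iff {f g : ℕ → Term Const} {c : Clause Const Pred} :
    c.bind f = c.bind g ↔ ∀ x ∈ c.vars, f x = g x := by
  simp only [Clause.bind, Clause.mk.injEq, Atom.bind_eq_bind_iff, List.map_inj_left,
    Clause.vars, Set.mem_union, Set.mem_ofPred_eq, atomsVars]
  grind

theorem Clause.bind_var (c : Clause Const Pred) : c.bind .var = c := by
  obtain ⟨h, as⟩ := c
  simp only [Clause.bind, Atom.bind_var, Clause.mk.injEq, true_and]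
  simpa using List.map_congr_left (fun t (_ : t ∈ as) => Atom.bind_var t)

theorem Atom.subst_comp (θ σ : Subst Const) (A : Atom Const Pred) :
    A.subst (θ.comp σ) = (A.subst θ).subst σ :=
  (Atom.bind_bind _ _ _).symm

theorem Subst.ext_toFun {θ σ : Subst Const} (h : ∀ x, θ.toFun x = σ.toFun x) : θ = σ := by
  cases θ; cases σ; simp only [Subst.mk.injEq]; exact funext h

theorem Subst.comp_assoc (θ σ τ : Subst Const) :
    (θ.comp σ).comp τ = θ.comp (σ.comp τ) :=
  Subst.ext_toFun fun _ => Term.bind_bind _ _ _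

theorem Subst.empty_comp (θ : Subst Const) : Subst.empty.comp θ = θ := rfl

theorem Subst.comp_empty (θ : Subst Const) : θ.comp Subst.empty = θ :=
  Subst.ext_toFun fun _ => Term.bind_var _

open scoped Classical in
/-- The substitution that agrees with `f` on the finite set `V` and is trivial elsewhere. -/
noncomputable def Subst.restrict (f : ℕ → Term Const) (V : Set ℕ) (hV : V.Finite) :
    Subst Const where
  toFun x := if x ∈ V then f x else .var x
  finite_support := hV.subset fun x hx => by
    by_contra h
    simp [h] at hx

theorem Subst.restrict_apply {f : ℕ → Term Const} {V : Set ℕ} {hV : V.Finite} {x : ℕ}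
    (hx : x ∈ V) : (Subst.restrict f V hV).toFun x = f x := by
  simp [Subst.restrict, hx]

/-! ## Most general unifiers -/

/-- A substitution that unifies two terms and through which every unifier factors. -/
theorem Term.exists_mgu {f : ℕ → Term Const} {s t : Term Const} (h : s.bind f = t.bind f) :
    ∃ θ : Subst Const, s.bind θ.toFun = t.bind θ.toFun ∧
      ∀ g : ℕ → Term Const, s.bind g = t.bind g → ∀ x, (θ.toFun x).bind g = g x := by
  classical
  by_cases hst : s = t
  · exact ⟨Subst.empty, by rw [hst], fun g _ x => rfl⟩
  have single : ∀ (x : ℕ) (t : Term Const), Term.var x ≠ t →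
      ∃ θ : Subst Const, (Term.var x).bind θ.toFun = t.bind θ.toFun ∧
      ∀ g : ℕ → Term Const, (Term.var x).bind g = t.bind g →
        ∀ y, (θ.toFun y).bind g = g y := by
    intro x t hxt
    refine ⟨⟨fun y => if y = x then t else .var y,
      (Set.finite_singleton x).subset fun y hy => ?_⟩, ?_, ?_⟩
    · by_contra hne
      simp_all
    · cases t with
      | var y =>
        have : y ≠ x := fun h => hxt (h ▸ rfl)
        simp [Term.bind, this]
      | const c => simp [Term.bind]
    · intro g hg y
      by_cases hy : y = x
      · simpa [hy, Term.bind] using hg.symm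
      · simp [hy, Term.bind]
  cases s with
  | var x => exact single x t hst
  | const c =>
    cases t with
    | var y =>
      obtain ⟨θ, h1, h2⟩ := single y (.const c) (Ne.symm hst)
      exact ⟨θ, h1.symm, fun g hg => h2 g hg.symm⟩
    | const d => exact absurd h hst

/-- Unify the tails by `θ`, then the `θ`-instances of the heads by `η`. Every unifier `g` satisfies
`θg = g`; in this strong form, with `g` itself as the factor, the property passes to the
composition. No occurs check arises, since terms are variables or constants. -/
theorem exists_mgu_of_map_eq {f : ℕ → Term Const} (L : List (Term Const)) :
    ∀ M : List (Term Const), L.map (Term.bind f) = M.map (Term.bind f) →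
    ∃ θ : Subst Const, L.map (Term.bind θ.toFun) = M.map (Term.bind θ.toFun) ∧
      ∀ g : ℕ → Term Const, L.map (Term.bind g) = M.map (Term.bind g) →
        ∀ x, (θ.toFun x).bind g = g x := by
  induction L with
  | nil =>
    intro M hM
    obtain rfl : M = [] := by simpa using hM
    exact ⟨Subst.empty, rfl, fun g _ x => rfl⟩
  | cons s L ih =>
    rintro (_ | ⟨t, M⟩) h
    · simp at h
    simp only [List.map_cons, List.cons.injEq] at h ⊢
    obtain ⟨θ, h1, h2⟩ := ih M h.2
    have key : ∀ g : ℕ → Term Const, L.map (Term.bind g) = M.map (Term.bind g) →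
        ∀ u : Term Const, (u.bind θ.toFun).bind g = u.bind g := fun g hg u => by
      rw [Term.bind_bind]; exact Term.bind_eq_bind_iff.2 fun x _ => h2 g hg x
    obtain ⟨η, h3, h4⟩ := Term.exists_mgu (f := f) (s := s.bind θ.toFun) (t := t.bind θ.toFun)
      (by rw [key f h.2, key f h.2, h.1])
    have comp : Term.bind (θ.comp η).toFun = fun u => (u.bind θ.toFun).bind η.toFun :=
      funext fun u => (Term.bind_bind _ _ _).symm
    refine ⟨θ.comp η, ⟨by rw [comp]; exact h3, ?_⟩, fun g hg x => ?_⟩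
    · have := congrArg (List.map (Term.bind η.toFun)) h1
      simpa only [List.map_map, Function.comp_def, comp] using this
    · have e := h4 g (by rw [key g hg.2, key g hg.2, hg.1])
      change ((θ.toFun x).bind η.toFun).bind g = g x
      rw [Term.bind_bind, ← h2 g hg.2 x]
      exact Term.bind_eq_bind_iff.2 fun y _ => e y

theorem exists_isMgu {f : ℕ → Term Const} {A B : Atom Const Pred} (h : A.bind f = B.bind f) :
    ∃ θ : Subst Const, IsMgu θ A B := by
  have conv : ∀ g : ℕ → Term Const, A.bind g = B.bind g ↔ A.pred = B.pred ∧
      (A.loc :: A.args).map (Term.bind g) = (B.loc :: B.args).map (Term.bind g) := fun g => by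
    simp [Atom.bind]
  obtain ⟨θ, h1, h2⟩ := exists_mgu_of_map_eq _ _ ((conv f).1 h).2
  exact ⟨θ, (conv _).2 ⟨((conv f).1 h).1, h1⟩, fun τ hτ =>
    ⟨τ, Subst.ext_toFun fun x => (h2 τ.toFun ((conv _).1 hτ).2 x).symm⟩⟩

/-! ## Instances of clauses -/

/-- The set of all instances of a clause. -/
def insts (c : Clause Const Pred) : Set (Clause Const Pred) := Set.range fun f => c.bind f

/-- The clauses obtained by replacing the first body atom of a clause of `X` by the body of a
clause of `Y` with that atom as its head. -/
def cut (X Y : Set (Clause Const Pred)) : Set (Clause Const Pred) :=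
  {d | ∃ h b ys bs, ⟨h, b :: bs⟩ ∈ X ∧ ⟨b, ys⟩ ∈ Y ∧ d = ⟨h, ys ++ bs⟩}

theorem self_mem_insts (c : Clause Const Pred) : c ∈ insts c := ⟨.var, c.bind_var⟩

theorem insts_bind_subset (f : ℕ → Term Const) (c : Clause Const Pred) :
    insts (c.bind f) ⊆ insts c := by
  rintro _ ⟨g, rfl⟩
  exact ⟨_, (c.bind_bind f g).symm⟩

/-- The inverse permutation recovers `c` from `c'`, so each is an instance of the other. -/
theorem Clause.Variant.insts_eq {c c' : Clause Const Pred} (h : c.Variant c') :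
    insts c' = insts c := by
  obtain ⟨ρ, rfl⟩ := h
  refine (insts_bind_subset _ _).antisymm ?_
  conv_lhs => rw [← c.bind_var]
  have : c.bind .var = (c.bind fun x => .var (ρ x)).bind fun x => .var (ρ.symm x) := by
    simp [Clause.bind_bind, Term.bind]
  rw [this]
  exact insts_bind_subset _ _

theorem Atom.Variant.clause {A A' : Atom Const Pred} (h : A.Variant A') :
    (Clause.mk A []).Variant ⟨A', []⟩ := by
  obtain ⟨ρ, rfl⟩ := h
  exact ⟨ρ, rfl⟩

/-- Variants are defined by permutations of all variables, whereas renamings arise only as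
injections on the finitely many variables that occur. -/
theorem exists_perm_extending {s : Set ℕ} (hs : s.Finite) (f : ℕ → ℕ) (hf : Set.InjOn f s) :
    ∃ ρ : Equiv.Perm ℕ, ∀ x ∈ s, ρ x = f x := by
  obtain ⟨ρ, hρ⟩ := Cardinal.extend_function_of_lt (s := s) (β := ℕ)
    ⟨fun x => f x, fun x y h => Subtype.ext (hf x.2 y.2 h)⟩
    (by simpa using hs) ⟨Equiv.refl ℕ⟩
  exact ⟨ρ, fun x hx => hρ ⟨x, hx⟩⟩

theorem exists_variant_disjoint (c : Clause Const Pred) {V : Set ℕ} (hV : V.Finite) :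
    ∃ c', c.Variant c' ∧ Disjoint c'.vars V := by
  -- Shifting by `N + 1`, with `N` a bound of `V`, leaves `V`; the shift is not onto, so only its
  -- values on the variables of `c` are kept.
  obtain ⟨N, hN⟩ := hV.bddAbove
  obtain ⟨ρ, hρ⟩ := exists_perm_extending c.finite_vars (fun x => x + (N + 1))
    (fun x _ y _ h => by simpa using h)
  have hterm : ∀ (t : Term Const) y, y ∈ (t.bind fun x => .var (ρ x)).vars →
      ∃ x ∈ t.vars, y = ρ x := by
    rintro (x | k) y hy <;> simp_all [Term.bind, Term.vars]
  have hatom : ∀ (A : Atom Const Pred) y, y ∈ (A.bind fun x => .var (ρ x)).vars →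
      ∃ x ∈ A.vars, y = ρ x := by
    rintro A y (hy | ⟨t, ht, hy⟩)
    · obtain ⟨x, hx, rfl⟩ := hterm _ _ hy
      exact ⟨x, Or.inl hx, rfl⟩
    · obtain ⟨u, hu, rfl⟩ := List.mem_map.1 ht
      obtain ⟨x, hx, rfl⟩ := hterm _ _ hy
      exact ⟨x, Or.inr ⟨u, hu, hx⟩, rfl⟩
  have hclause : ∀ y ∈ (c.bind fun x => .var (ρ x)).vars, ∃ x ∈ c.vars, y = ρ x := by
    rintro y (hy | ⟨A, hA, hy⟩)
    · obtain ⟨x, hx, rfl⟩ := hatom _ _ hy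
      exact ⟨x, Or.inl hx, rfl⟩
    · obtain ⟨B, hB, rfl⟩ := List.mem_map.1 hA
      obtain ⟨x, hx, rfl⟩ := hatom _ _ hy
      exact ⟨x, Or.inr ⟨B, hB, hx⟩, rfl⟩
  refine ⟨_, ⟨ρ, rfl⟩, Set.disjoint_left.2 fun y hy hyV => ?_⟩
  obtain ⟨x, hx, rfl⟩ := hclause y hy
  have h1 := hN hyV
  rw [hρ x hx] at h1
  omega

/-- On the variables of `A`, `f` followed by `g` is the identity; hence `f` takes them to variables,
and injectively. -/
theorem variant_of_bind {A B : Atom Const Pred} {f g : ℕ → Term Const}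
    (hf : B = A.bind f) (hg : A = B.bind g) : A.Variant B := by
  have hfg : ∀ x ∈ A.vars, (f x).bind g = .var x := by
    refine Atom.bind_eq_bind_iff.1 ?_
    rw [← Atom.bind_bind, ← hf, ← hg, Atom.bind_var]
  have hvar : ∀ x ∈ A.vars, ∃ y, f x = .var y := by
    intro x hx
    have := hfg x hx
    cases hfx : f x with
    | var y => exact ⟨y, rfl⟩
    | const k => simp [hfx, Term.bind] at this
  choose! k hk using hvar
  obtain ⟨ρ, hρ⟩ := exists_perm_extending A.finite_vars k (fun x hx y hy h => by
    have h1 := hfg x hx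
    have h2 := hfg y hy
    rw [hk x hx, h, ← hk y hy, h2] at h1
    simpa using h1.symm)
  refine ⟨ρ, hf.trans (Atom.bind_eq_bind_iff.2 fun x hx => ?_)⟩
  rw [hk x hx, hρ x hx]

theorem variant_of_insts_eq {A B : Atom Const Pred} {L M : List (Atom Const Pred)}
    (h : insts ⟨A, L⟩ = insts ⟨B, M⟩) : A.Variant B := by
  obtain ⟨f, hf⟩ : (⟨B, M⟩ : Clause Const Pred) ∈ insts ⟨A, L⟩ := h ▸ self_mem_insts _
  obtain ⟨g, hg⟩ : (⟨A, L⟩ : Clause Const Pred) ∈ insts ⟨B, M⟩ := h ▸ self_mem_insts _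
  exact variant_of_bind (congrArg Clause.head hf).symm (congrArg Clause.head hg).symm

/-- Without common variables, two instantiations merge into one. Cutting it down to the variables
that occur makes it finitely supported, as `IsMgu` requires. -/
theorem exists_bind_of_mem_insts {c c' : Clause Const Pred} (hdisj : Disjoint c'.vars c.vars)
    (f g : ℕ → Term Const) :
    ∃ τ : Subst Const, c.bind τ.toFun = c.bind f ∧ c'.bind τ.toFun = c'.bind g := by
  classical
  refine ⟨Subst.restrict (fun x => if x ∈ c.vars then f x else g x) (c.vars ∪ c'.vars)
    (c.finite_vars.union c'.finite_vars), ?_, ?_⟩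
  · refine Clause.bind_eq_bind_iff.2 fun x hx => ?_
    rw [Subst.restrict_apply (Or.inl hx), if_pos hx]
  · refine Clause.bind_eq_bind_iff.2 fun x hx => ?_
    rw [Subst.restrict_apply (Or.inr hx), if_neg (Set.disjoint_left.1 hdisj hx)]

/-- The instances of a resolvent are the cuts of the instances of the two clauses. -/
theorem insts_resolvent {H B : Atom Const Pred} {Bs : List (Atom Const Pred)}
    {c' : Clause Const Pred} {θ : Subst Const}
    (hdisj : Disjoint c'.vars (Clause.mk H (B :: Bs)).vars) (hθ : IsMgu θ B c'.head) :
    insts ((Clause.mk H (c'.body ++ Bs)).subst θ) = cut (insts ⟨H, B :: Bs⟩) (insts c') := by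
  ext d
  constructor
  · rintro ⟨f, rfl⟩
    refine ⟨_, _, _, _, ⟨fun x => (θ.toFun x).bind f, rfl⟩,
      ⟨fun x => (θ.toFun x).bind f,
        (?_ : _ = Clause.mk _ (c'.body.map (Atom.bind fun x => (θ.toFun x).bind f)))⟩, ?_⟩
    · have : (B.subst θ).bind f = (c'.head.subst θ).bind f := congrArg _ hθ.1
      simp only [Atom.subst, Atom.bind_bind] at this
      simp only [Clause.bind, this]
    · simp only [Clause.subst, Clause.bind_bind]
      simp [Clause.bind]
  · rintro ⟨h, b, ys, bs, ⟨f, hf⟩, ⟨g, hg⟩, rfl⟩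
    obtain ⟨τ, h1, h2⟩ := exists_bind_of_mem_insts hdisj f g
    have e1 := h1.trans hf
    have e2 := h2.trans hg
    simp only [Clause.bind, List.map_cons, Clause.mk.injEq, List.cons.injEq] at e1 e2
    -- The merged substitution unifies `B` with the head of `c'`, so it factors through `θ`; the
    -- factor is the required instantiation of the resolvent.
    obtain ⟨γ, rfl⟩ := hθ.2 τ (e1.2.1.trans e2.1.symm)
    refine ⟨γ.toFun, ?_⟩
    simp only [Clause.subst, Clause.bind_bind]
    change Clause.bind (θ.comp γ).toFun _ = _
    simp only [Clause.bind, List.map_append, e1.1, e1.2.2, e2.2]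

theorem exists_isMgu_of_cut_nonempty {H B : Atom Const Pred} {Bs : List (Atom Const Pred)}
    {c' : Clause Const Pred} (hdisj : Disjoint c'.vars (Clause.mk H (B :: Bs)).vars)
    (h : (cut (insts ⟨H, B :: Bs⟩) (insts c')).Nonempty) :
    ∃ θ : Subst Const, IsMgu θ B c'.head := by
  obtain ⟨_, h, b, ys, bs, ⟨f, hf⟩, ⟨g, hg⟩, rfl⟩ := h
  obtain ⟨τ, h1, h2⟩ := exists_bind_of_mem_insts hdisj f g
  have e1 := h1.trans hf
  have e2 := h2.trans hg
  simp only [Clause.bind, List.map_cons, Clause.mk.injEq, List.cons.injEq] at e1 e2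
  exact exists_isMgu (e1.2.1.trans e2.1.symm)

/-- If `Y` contained a fact, the second cut on the left would act on an atom left over from `X`, and
the one on the right would not exist; hence the hypothesis on bodies. -/
theorem cut_assoc {X Y Z : Set (Clause Const Pred)} (hY : ∀ c ∈ Y, c.body ≠ []) :
    cut (cut X Y) Z = cut X (cut Y Z) := by
  ext d
  constructor
  · rintro ⟨h, b, ys, bs, ⟨h', b', ys', bs', hx, hy, e⟩, hz, rfl⟩
    simp only [Clause.mk.injEq] at e
    obtain ⟨rfl, e⟩ := e
    rcases ys' with _ | ⟨y, ys'⟩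
    · exact absurd rfl (hY _ hy)
    obtain ⟨rfl, rfl⟩ := List.cons.inj e
    exact ⟨_, _, _, _, hx, ⟨_, _, _, _, hy, hz, rfl⟩, by simp⟩
  · rintro ⟨h, b, ys, bs, hx, ⟨h', b', ys', bs', hy, hz, e⟩, rfl⟩
    obtain ⟨rfl, rfl⟩ := Clause.mk.inj e
    exact ⟨_, _, _, _, ⟨_, _, _, _, hx, hy, rfl⟩, hz, by simp⟩

theorem cut_insts_tautology (H B : Atom Const Pred) (Bs : List (Atom Const Pred)) :
    cut (insts ⟨H, B :: Bs⟩) (insts ⟨B, [B]⟩) = insts ⟨H, B :: Bs⟩ := by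
  ext d
  constructor
  · rintro ⟨h, b, ys, bs, hx, ⟨g, hg⟩, rfl⟩
    simp only [Clause.bind, Clause.mk.injEq, List.map_cons, List.map_nil] at hg
    obtain ⟨rfl, rfl⟩ := hg
    exact hx
  · rintro ⟨f, rfl⟩
    exact ⟨_, _, _, _, ⟨f, rfl⟩, ⟨f, rfl⟩, rfl⟩

theorem body_ne_nil_of_mem_insts {H B : Atom Const Pred} {Bs : List (Atom Const Pred)} :
    ∀ c ∈ insts ⟨H, B :: Bs⟩, c.body ≠ [] := by
  rintro _ ⟨f, rfl⟩
  simp [Clause.bind]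

/-! ## Sets of instances of derivable resultants -/

/-- `X` is obtained from the instances of `A ← A` by repeated cuts with the instances of
clauses of `P`: it is the set of the instances of the resultant of an SLD derivation of
`P ∪ {← A}`, or it is empty. -/
inductive Derivable (P : Set (Clause Const Pred)) (A : Atom Const Pred) :
    Set (Clause Const Pred) → Prop
  | init : Derivable P A (insts ⟨A, [A]⟩)
  | step {X : Set (Clause Const Pred)} {c : Clause Const Pred} (hX : Derivable P A X)
      (hne : ∀ d ∈ X, d.body ≠ []) (hc : c ∈ P) : Derivable P A (cut X (insts c))

/-- The splicing step: `B ← B` is a unit, and by associativity each cut in the derivation for `B`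
becomes a further cut in the derivation for `A`. -/
theorem Derivable.cut {P : Set (Clause Const Pred)} {A H B : Atom Const Pred}
    {Bs : List (Atom Const Pred)} {Y : Set (Clause Const Pred)}
    (h : Derivable P A (insts ⟨H, B :: Bs⟩)) (hY : Derivable P B Y) :
    Derivable P A (cut (insts ⟨H, B :: Bs⟩) Y) := by
  induction hY with
  | init => rwa [cut_insts_tautology]
  | step _ hne hc ih =>
    rw [← cut_assoc hne]
    refine ih.step ?_ hc
    rintro _ ⟨_, _, ys, _, _, hy, rfl⟩
    have := hne _ hy
    simp_all

theorem Derivable.head_mem {P : Set (Clause Const Pred)} {A : Atom Const Pred}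
    {X : Set (Clause Const Pred)} (h : Derivable P A X) :
    ∀ c ∈ X, ∃ f, c.head = A.bind f := by
  induction h with
  | init =>
    rintro _ ⟨f, rfl⟩
    exact ⟨f, rfl⟩
  | step _ _ _ ih =>
    rintro _ ⟨_, _, _, _, hx, _, rfl⟩
    obtain ⟨f, hf⟩ := ih _ hx
    exact ⟨f, hf⟩

theorem Derivable.exists_subst {P : Set (Clause Const Pred)} {A : Atom Const Pred}
    {c : Clause Const Pred} (h : Derivable P A (insts c)) :
    ∃ θ : Subst Const, c.head = A.subst θ := by
  obtain ⟨f, hf⟩ := h.head_mem c (self_mem_insts c)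
  exact ⟨Subst.restrict f A.vars A.finite_vars, hf.trans
    (Atom.bind_eq_bind_iff.2 fun x hx => (Subst.restrict_apply hx).symm)⟩

/-- The instances of `A ← A` arise from those of the fact `A` by copying the head into the body. -/
theorem insts_tautology_eq {A B : Atom Const Pred}
    (h : insts (⟨A, []⟩ : Clause Const Pred) = insts ⟨B, []⟩) :
    insts (⟨A, [A]⟩ : Clause Const Pred) = insts ⟨B, [B]⟩ := by
  have aux : ∀ A : Atom Const Pred, insts (⟨A, [A]⟩ : Clause Const Pred) =
      (fun c => ⟨c.head, [c.head]⟩) '' insts ⟨A, []⟩ := fun A => by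
    ext d
    simp [insts, Clause.bind]
  rw [aux, aux, h]

theorem Derivable.congr {P : Set (Clause Const Pred)} {A B : Atom Const Pred}
    {X : Set (Clause Const Pred)} (h : Derivable P A X)
    (hAB : insts (⟨A, []⟩ : Clause Const Pred) = insts ⟨B, []⟩) : Derivable P B X := by
  induction h with
  | init => rw [insts_tautology_eq hAB]; exact .init
  | step _ hne hc ih => exact ih.step hne hc

theorem ClauseStep.derivable {P : Set (Clause Const Pred)} {A : Atom Const Pred}
    {c d : Clause Const Pred} (h : ClauseStep A c d) (hc : c ∈ P) :
    Derivable P A (insts d) := by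
  obtain ⟨c', hvar, hdisj, θ, hθ, rfl⟩ := h
  have hdisj' : Disjoint c'.vars (Clause.mk A [A]).vars := by
    simpa [Clause.vars, atomsVars] using hdisj
  have e := insts_resolvent hdisj' hθ
  -- The resolvent of `A ← A` with `c'` has head `Aθ`, the child node has the head of `c'` under
  -- `θ`; the unifier makes them equal.
  have : (Clause.mk A (c'.body ++ [])).subst θ = c'.subst θ := by
    have h1 : A.bind θ.toFun = c'.head.bind θ.toFun := hθ.1
    simp [Clause.subst, Clause.bind, h1]
  rw [← this, e, hvar.insts_eq]
  exact Derivable.init.step body_ne_nil_of_mem_insts hc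

/-- The answer acts as an input clause with empty body, and its renaming does not affect the
instance set. -/
theorem AnswerStep.derivable {P : Set (Clause Const Pred)} {A B H : Atom Const Pred}
    {Bs : List (Atom Const Pred)} {c d : Clause Const Pred} (h : AnswerStep c H d)
    (hc : Derivable P A (insts c)) (hbody : c.body = B :: Bs)
    (hH : Derivable P B (insts ⟨H, []⟩)) : Derivable P A (insts d) := by
  obtain ⟨B', Bs', H', hbody', hvar, hdisj, θ, hθ, rfl⟩ := h
  obtain ⟨h, _⟩ := c
  subst hbody
  obtain ⟨rfl, rfl⟩ := List.cons.inj hbody'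
  have e := insts_resolvent (c' := ⟨H', []⟩) (by simpa [Clause.vars, atomsVars] using hdisj) hθ
  rw [List.nil_append] at e
  rw [e, hvar.clause.insts_eq]
  exact hc.cut hH

/-! ## From derivable sets to SLD derivations -/

/-- `SLDDerivation` grows at the front, `Derivable` at the end. `V` gathers the variables of the
input clauses and mgus already used, which a further input clause must avoid. -/
theorem SLDDerivation.snoc {P : Set (Clause Const Pred)} {W : Set ℕ}
    {G G' : List (Atom Const Pred)} {σ : Subst Const} (h : SLDDerivation P W G σ G') :
    ∃ V : Set ℕ, V.Finite ∧ ∀ c' θ G'', Resolvent P c' θ G' G'' →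
      Disjoint c'.vars (W ∪ V) → SLDDerivation P W G (σ.comp θ) G'' := by
  induction h with
  | refl W G =>
    refine ⟨∅, Set.finite_empty, fun c' θ G'' hres hdisj => ?_⟩
    rw [Subst.empty_comp, ← Subst.comp_empty θ]
    exact .step hres (by simpa using hdisj) (.refl _ _)
  | @step W G G₁ G₂ c θ σ hres hdisj _ ih =>
    obtain ⟨V, hV, ih⟩ := ih
    refine ⟨V ∪ (c.vars ∪ θ.vars), hV.union (c.finite_vars.union θ.finite_vars),
      fun c' θ' G'' hres' hdisj' => ?_⟩
    rw [Subst.comp_assoc]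
    refine .step hres hdisj (ih _ _ _ hres' (hdisj'.mono_right ?_))
    intro x
    simp only [Set.mem_union]
    tauto

theorem Derivable.exists_sldDerivation {P : Set (Clause Const Pred)} {A : Atom Const Pred}
    {X : Set (Clause Const Pred)} (h : Derivable P A X) (hX : X.Nonempty) :
    ∃ σ G', SLDDerivation P (atomsVars [A]) [A] σ G' ∧ insts ⟨A.subst σ, G'⟩ = X := by
  induction h with
  | init =>
    refine ⟨_, _, .refl _ _, ?_⟩
    have : A.subst Subst.empty = A := A.bind_var
    rw [this]
  | @step X c _ hne hc ih =>
    obtain ⟨σ, G', hder, rfl⟩ := ih (by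
      obtain ⟨_, _, _, _, _, hx, _⟩ := hX
      exact ⟨_, hx⟩)
    rcases G' with _ | ⟨B, Bs⟩
    · exact absurd rfl (hne _ (self_mem_insts _))
    obtain ⟨V, hV, hsnoc⟩ := hder.snoc
    -- Besides the initial goal and `V`, the variant avoids the whole resultant, including its head
    -- `Aσ`: `insts_resolvent` needs this. Nonemptiness of the cut then yields the mgu.
    obtain ⟨c', hvar, hdisj⟩ := exists_variant_disjoint c
      (((finite_atomsVars [A]).union hV).union (Clause.mk (A.subst σ) (B :: Bs)).finite_vars)
    rw [Set.disjoint_union_right] at hdisj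
    rw [← hvar.insts_eq] at hX ⊢
    obtain ⟨θ, hθ⟩ := exists_isMgu_of_cut_nonempty hdisj.2 hX
    refine ⟨_, _, hsnoc c' θ _ ⟨⟨c, hc, hvar⟩, hdisj.2.mono_right Set.subset_union_right,
      B, Bs, rfl, hθ, rfl⟩ hdisj.1, ?_⟩
    rw [← insts_resolvent hdisj.2 hθ, Atom.subst_comp]
    rfl

theorem Derivable.exists_isCAS {P : Set (Clause Const Pred)} {A H : Atom Const Pred}
    (h : Derivable P A (insts ⟨H, []⟩)) :
    ∃ σ : Subst Const, IsCAS P [A] σ ∧ (A.subst σ).Variant H := by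
  obtain ⟨σ, G', hder, e⟩ := h.exists_sldDerivation ⟨_, self_mem_insts _⟩
  obtain rfl : G' = [] := by
    obtain ⟨f, hf⟩ : (⟨A.subst σ, G'⟩ : Clause Const Pred) ∈ insts ⟨H, []⟩ :=
      -- All instances of a fact are facts, so no goal atoms remain.
      e ▸ self_mem_insts _
    exact (congrArg Clause.body hf).symm
  exact ⟨σ, hder, variant_of_insts_eq e⟩

/-! ## The invariant of the computation -/

/-- `N` records the clauses of the nodes by identifier, `U` the identifiers in use. -/
structure Registry (N : Set (Ident × Clause Const Pred)) (U : Set Ident) : Prop where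
  functional : ∀ i c c', (i, c) ∈ N → (i, c') ∈ N → c = c'
  mem : ∀ i c, (i, c) ∈ N → i ∈ U

/-- Extension of a registry by nodes with fresh identifiers. -/
structure Extends (N : Set (Ident × Clause Const Pred)) (U : Set Ident)
    (N' : Set (Ident × Clause Const Pred)) (U' : Set Ident) : Prop where
  nodes : N ⊆ N'
  ids : U ⊆ U'
  fresh : ∀ i c, (i, c) ∈ N' → (i, c) ∈ N ∨ i ∉ U

/-- A request for `← G` with identifier `i` is justified: the nodes with this identifier have a
variant of `G` as their first body atom. -/
structure Serves (N : Set (Ident × Clause Const Pred)) (U : Set Ident) (i : Ident)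
    (G : Atom Const Pred) : Prop where
  mem : i ∈ U
  body : ∀ c, (i, c) ∈ N →
    ∃ B Bs, c.body = B :: Bs ∧ insts (⟨B, []⟩ : Clause Const Pred) = insts ⟨G, []⟩

/-- A request is justified and the answers in a response are derivable for a request that
justifies it. -/
def MessageOK (P : Set (Clause Const Pred)) (N : Set (Ident × Clause Const Pred))
    (U : Set Ident) : Message Const Pred → Prop
  | .request r => Serves N U r.id r.goal
  | .response _ r => ∃ G, Serves N U r.id G ∧ ∀ H ∈ r.ans, Derivable P G (insts ⟨H, []⟩)

/-- The identifiers of the nodes of the evaluation tree. -/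
def Table.ids (T : Table Const Pred) : Set Ident :=
  {i | i = T.root.id ∨ ∃ t ∈ T.nodes, i = t.id}

/-- The table `T` of `← G` contains only derivable clauses and answers, and its evaluation tree
contains the identifiers `I`. -/
structure TableOK (P : Set (Clause Const Pred)) (N : Set (Ident × Clause Const Pred))
    (U I : Set Ident) (G : Atom Const Pred) (T : Table Const Pred) : Prop where
  hr : ∀ r, T.hr = some r → Serves N U r.id G
  lr : ∀ r ∈ T.lr, Serves N U r.id G
  ans : ∀ p ∈ T.ans, Derivable P G (insts ⟨p.1, []⟩)
  mem : ∀ t ∈ T.nodes, (t.id, t.clause) ∈ N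
  derivable : ∀ t ∈ T.nodes, Derivable P G (insts t.clause)
  answer : ∀ t ∈ T.nodes, t.status = .answer → t.clause.body = []
  ids : I ⊆ T.ids

variable {P : Set (Clause Const Pred)} {N N' : Set (Ident × Clause Const Pred)}
  {U U' I : Set Ident} {G : Atom Const Pred} {T T' : Table Const Pred}
  {ms : Multiset (Message Const Pred)}

/-! ### Stability of the table invariant under the procedures -/

theorem Serves.mono {i : Ident} (h : Serves N U i G) (he : Extends N U N' U') :
    Serves N' U' i G :=
  -- An identifier in use never receives a new clause.
  ⟨he.ids h.mem, fun c hc => h.body c ((he.fresh i c hc).resolve_right (not_not.2 h.mem))⟩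

theorem Serves.congr {i : Ident} {G' : Atom Const Pred} (h : Serves N U i G)
    (hG : G.Variant G') : Serves N U i G' :=
  ⟨h.mem, fun c hc => by rw [hG.clause.insts_eq]; exact h.body c hc⟩

theorem MessageOK.mono {m : Message Const Pred} (h : MessageOK P N U m)
    (he : Extends N U N' U') : MessageOK P N' U' m := by
  cases m with
  | request r => exact Serves.mono h he
  | response a r =>
    obtain ⟨G, h1, h2⟩ := h
    exact ⟨G, h1.mono he, h2⟩

theorem TableOK.mono (h : TableOK P N U I G T) (he : Extends N U N' U') :
    TableOK P N' U' I G T :=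
  { h with
    hr := fun r hr => (h.hr r hr).mono he
    lr := fun r hr => (h.lr r hr).mono he
    mem := fun t ht => he.nodes (h.mem t ht) }

/-- Starting from the identifiers of the table itself, the later lemmas record that none of them is
lost. -/
theorem TableOK.with_ids (h : TableOK P N U I G T) : TableOK P N U T.ids G T :=
  { h with ids := subset_rfl }

theorem TableOK.setActive (h : TableOK P N U I G T) (f : Ident → Option ℤ) :
    TableOK P N U I G { T with active := f } :=
  ⟨h.hr, h.lr, h.ans, h.mem, h.derivable, h.answer, h.ids⟩

theorem TableOK.setRoot (h : TableOK P N U I G T) (S : NodeStatus) :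
    TableOK P N U I G (T.setRoot S) :=
  ⟨h.hr, h.lr, h.ans, h.mem, h.derivable, h.answer, h.ids⟩

theorem TableOK.mapNodes (h : TableOK P N U I G T) {root : Node Const Pred}
    {f : Node Const Pred → Node Const Pred} (hroot : root.id = T.root.id)
    (hid : ∀ t, (f t).id = t.id) (hclause : ∀ t, (f t).clause = t.clause)
    (hstatus : ∀ t ∈ T.nodes, (f t).status = .answer → t.clause.body = []) :
    TableOK P N U I G { T with root := root, nodes := T.nodes.map f } := by
  refine ⟨h.hr, h.lr, h.ans, ?_, ?_, ?_, fun i hi => ?_⟩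
  · simpa [hid, hclause] using h.mem
  · simpa [hclause] using h.derivable
  · simpa [hclause] using hstatus
  · have := h.ids hi
    simpa [Table.ids, hid, hroot] using this

theorem TableOK.setNode (h : TableOK P N U I G T) (i : Ident) (S : NodeStatus)
    (hS : S = .answer → ∀ t ∈ T.nodes, t.id = i → t.clause.body = []) :
    TableOK P N U I G (T.setNode i S) := by
  refine h.mapNodes rfl (fun t => ?_) (fun t => ?_) (fun t ht => ?_)
  · split_ifs <;> rfl
  · split_ifs <;> rfl
  · split_ifs with hi
    · exact fun hs => hS hs t ht hi
    · exact h.answer t ht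

theorem TableOK.disposeIf (h : TableOK P N U I G T) (p : NodeStatus → Prop) :
    TableOK P N U I G (T.disposeIf p) := by
  refine h.mapNodes ?_ (fun t => ?_) (fun t => ?_) (fun t ht => ?_)
  · dsimp only
    split_ifs <;> rfl
  · split_ifs <;> rfl
  · split_ifs <;> rfl
  · split_ifs
    · intro hs
      cases hs
    · exact h.answer t ht

theorem TableOK.startRoot (h : TableOK P N U I G T) : TableOK P N U I G T.startRoot := by
  unfold Table.startRoot
  split_ifs
  · exact h.setRoot _
  · exact h

theorem Table.startRoot_nodes (T : Table Const Pred) : T.startRoot.nodes = T.nodes := by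
  unfold Table.startRoot
  split_ifs <;> rfl

theorem TableOK.addAnswer (h : TableOK P N U I G T) {H : Atom Const Pred}
    (hH : Derivable P G (insts ⟨H, []⟩)) : TableOK P N U I G (T.addAnswer H) := by
  unfold Table.addAnswer
  split_ifs
  · exact h
  · refine ⟨h.hr, h.lr, fun p hp => ?_, h.mem, h.derivable, h.answer, h.ids⟩
    rcases List.mem_append.1 hp with hp | hp
    · exact h.ans p hp
    · obtain rfl := List.mem_singleton.1 hp
      exact hH

theorem TableOK.sendResponse (h : TableOK P N U I G T) {r : Request Const Pred}
    (hr : Serves N U r.id G) (S : RespStatus) (L : Set Ident) :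
    TableOK P N U I G (sendResponse r S L T).1 ∧ MessageOK P N U (sendResponse r S L T).2 := by
  refine ⟨⟨h.hr, h.lr, fun p hp => ?_, h.mem, h.derivable, h.answer, h.ids⟩, G, hr,
    fun H hH => ?_⟩
  · obtain ⟨q, hq, rfl⟩ := List.mem_map.1 hp
    exact h.ans q hq
  · obtain ⟨q, hq, rfl⟩ := List.mem_map.1 hH
    exact h.ans q (List.mem_filter.1 hq).1

theorem TableOK.sendAll (S : RespStatus) (L : Set Ident) (rs : List (Request Const Pred)) :
    ∀ {T : Table Const Pred}, TableOK P N U I G T → (∀ r ∈ rs, Serves N U r.id G) →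
      TableOK P N U I G (sendAll S L rs T).1 ∧
        ∀ m ∈ (GEM.sendAll S L rs T).2, MessageOK P N U m := by
  induction rs with
  | nil => exact fun h _ => ⟨h, fun m hm => absurd hm (Multiset.notMem_zero m)⟩
  | cons r rs ih =>
    intro T h hrs
    obtain ⟨h1, h2⟩ := h.sendResponse (hrs r List.mem_cons_self) S L
    obtain ⟨h3, h4⟩ := ih h1 fun r' hr' => hrs r' (List.mem_cons_of_mem _ hr')
    refine ⟨h3, fun m hm => ?_⟩
    rcases Multiset.mem_cons.1 hm with rfl | hm
    · exact h2
    · exact h4 m hm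

theorem TableOK.terminate (h : TableOK P N U I G T) :
    TableOK P N U I G (terminate T).1 ∧ ∀ m ∈ (terminate T).2, MessageOK P N U m := by
  obtain ⟨h1, h2⟩ := TableOK.sendAll .disposed ∅ (T.hr.toList ++ T.lr)
    (h.disposeIf (· ≠ .answer)) fun r hr => by
      rcases List.mem_append.1 hr with hr | hr
      · exact h.hr r (by simpa using hr)
      · exact h.lr r hr
  exact ⟨⟨fun _ h => (by cases h), fun _ h => (by cases h), h1.ans, h1.mem, h1.derivable, h1.answer,
    h1.ids⟩, h2⟩

theorem TableOK.generateResponse (h : TableOK P N U I G T) (hgen : GenerateResponse T T' ms) :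
    TableOK P N U I G T' ∧ ∀ m ∈ ms, MessageOK P N U m := by
  cases hgen with
  | noLoop => exact h.terminate
  | coordinator _ _ x hx =>
    subst hx
    exact TableOK.sendAll _ _ _ ((h.setActive _).setRoot _) h.lr
  | leader => exact h.terminate
  | inLoop _ _ _ hr hhr i _ x hx =>
    subst hx
    obtain ⟨h1, h2⟩ := (h.setActive _).sendResponse (h.hr _ hhr) _ _
    exact ⟨h1.setRoot _, fun m hm => by obtain rfl := Multiset.mem_singleton.1 hm; exact h2⟩
  | active _ _ _ hr hhr _ x hx =>
    subst hx
    obtain ⟨h1, h2⟩ := (h.setActive _).sendResponse (h.hr _ hhr) _ _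
    exact ⟨h1.setRoot _, fun m hm => by obtain rfl := Multiset.mem_singleton.1 hm; exact h2⟩

theorem TableOK.activateNode (hN : Registry N U) {a : Const} {A : Atom Const Pred} {b : Bool}
    (hact : ActivateNode a A T T' ms b) (h : TableOK P N U I G T) :
    TableOK P N U I G T' ∧ ∀ m ∈ ms, MessageOK P N U m := by
  induction hact with
  | generate _ hgen => exact h.generateResponse hgen
  | @fact T _ _ _ _ t ht hbody _ ih =>
    refine ih (TableOK.addAnswer (h.startRoot.setNode _ _ fun _ u hu hid => ?_) ?_)
    · rw [Table.startRoot_nodes] at hu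
      -- `setNode` marks every node with the identifier of `t`; functionality of the registry gives
      -- them all the same, bodiless clause.
      rw [← hbody, hN.functional t.id u.clause t.clause (hid ▸ h.mem u hu) (h.mem t ht.1)]
    · have := h.derivable t ht.1
      rwa [show t.clause = ⟨t.clause.head, []⟩ by rw [← hbody]] at this
  | flounder =>
    exact ⟨h.startRoot, fun m hm => absurd hm (Multiset.notMem_zero m)⟩
  | @request T _ t ht B Bs hbody _ =>
    refine ⟨h.startRoot.setNode _ _ (fun hs => by cases hs), fun m hm => ?_⟩
    obtain rfl := Multiset.mem_singleton.1 hm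
    have hmem := h.mem t ht.1
    refine ⟨hN.mem _ _ hmem, fun c hc => ⟨B, Bs, ?_, rfl⟩⟩
    rw [hN.functional _ _ _ hc hmem, hbody]

/-- Nodes only become looping or disposed here, so no new answer node appears. -/
theorem TableOK.updateStatus (h : TableOK P N U I G T) (r : Response Const Pred)
    (t : Node Const Pred) : TableOK P N U I G (updateStatus r t T) := by
  have hset : ∀ {T : Table Const Pred}, TableOK P N U I G T → ∀ i ids,
      TableOK P N U I G (T.setNode i (.loop ids)) := fun h i ids =>
    h.setNode _ _ (fun hs => by cases hs)
  have hite : ∀ {p : Prop} {_ : Decidable p} {T₁ T₂ : Table Const Pred}, TableOK P N U I G T₁ →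
      TableOK P N U I G T₂ → TableOK P N U I G (if p then T₁ else T₂) := fun h₁ h₂ => by
    split_ifs <;> assumption
  unfold GEM.updateStatus
  split
  · refine TableOK.setNode ?_ _ _ (fun hs => by cases hs)
    exact hite (h.disposeIf _) h
  · have h1 : TableOK P N U I G (match t.status with
        | .loop ids => T.setNode t.id (.loop (ids ∪ r.loops))
        | _ => if r.loops ≠ ∅ then T.setNode t.id (.loop r.loops) else T) := by
      split
      · exact hset h _ _
      · exact hite (hset h _ _) h
    dsimp only
    split
    · exact hite (((h1.setActive _).setActive _).setRoot _) ((h1.setActive _).setActive _)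
    · exact h1.setActive _

/-! ## New nodes -/

/-- The registry extended by the nodes `subs`. -/
def registerNodes (N : Set (Ident × Clause Const Pred)) (subs : List (Node Const Pred)) :
    Set (Ident × Clause Const Pred) :=
  N ∪ {p | ∃ t ∈ subs, p = (t.id, t.clause)}

/-- The room between `U` and `U'` is for the identifier of a new root, which comes into use without
being registered. -/
theorem Registry.registerNodes (hN : Registry N U) (hU : U ⊆ U')
    {subs : List (Node Const Pred)} (hnodup : (subs.map Node.id).Nodup)
    (hfresh : ∀ t ∈ subs, t.id ∉ U') :
    Registry (registerNodes N subs) (U' ∪ {i | ∃ t ∈ subs, i = t.id}) ∧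
      Extends N U (GEM.registerNodes N subs) (U' ∪ {i | ∃ t ∈ subs, i = t.id}) := by
  refine ⟨⟨?_, ?_⟩, Set.subset_union_left, hU.trans Set.subset_union_left, ?_⟩
  · rintro i c c' (h | ⟨t, ht, e⟩) (h' | ⟨t', ht', e'⟩)
    · exact hN.functional i c c' h h'
    · obtain ⟨rfl, rfl⟩ := Prod.mk.inj e'
      exact absurd (hU (hN.mem _ _ h)) (hfresh t' ht')
    · obtain ⟨rfl, rfl⟩ := Prod.mk.inj e
      exact absurd (hU (hN.mem _ _ h')) (hfresh t ht)
    · obtain ⟨rfl, rfl⟩ := Prod.mk.inj e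
      obtain ⟨hid, rfl⟩ := Prod.mk.inj e'
      rw [List.inj_on_of_nodup_map hnodup ht ht' hid]
  · rintro i c (h | ⟨t, ht, e⟩)
    · exact Or.inl (hU (hN.mem _ _ h))
    · exact Or.inr ⟨t, ht, congrArg Prod.fst e⟩
  · rintro i c (h | ⟨t, ht, e⟩)
    · exact Or.inl h
    · obtain ⟨rfl, rfl⟩ := Prod.mk.inj e
      exact Or.inr fun h => hfresh t ht (hU h)

theorem NewChildren.clause_mem {used : Set Ident} {i : Ident} {pos : List ℕ} {k : ℕ}
    {cls : List (Clause Const Pred)} {subs : List (Node Const Pred)}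
    (h : NewChildren used i pos k cls subs) {t : Node Const Pred} (ht : t ∈ subs) :
    t.clause ∈ cls :=
  h.1 ▸ List.mem_map_of_mem ht

theorem exists_of_forall₂_of_mem {α β : Type*} {R : α → β → Prop} {l : List α} {m : List β}
    (h : List.Forall₂ R l m) {b : β} (hb : b ∈ m) : ∃ a ∈ l, R a b := by
  induction h with
  | nil => cases hb
  | cons hab _ ih =>
    rcases List.mem_cons.1 hb with rfl | hb
    · exact ⟨_, List.mem_cons_self, hab⟩
    · obtain ⟨a, ha, h⟩ := ih hb
      exact ⟨a, List.mem_cons_of_mem _ ha, h⟩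

/-- `t` is the node before its status was updated, so its clause is tied to the registry by separate
hypotheses and not by membership in `T`. -/
theorem TableOK.addAnswers (hN : Registry N U) {used : Set Ident} (hU : U ⊆ used)
    (h : TableOK P N U I G T) {r : Response Const Pred} {a : Const}
    (hr : MessageOK P N U (.response a r)) {t : Node Const Pred}
    (ht : (t.id, t.clause) ∈ N) (hder : Derivable P G (insts t.clause)) (hid : t.id = r.id)
    (hadd : AddAnswers used r t T T') :
    ∃ N' U' I', Registry N' U' ∧ Extends N U N' U' ∧ U' ⊆ U ∪ I' ∧ I ⊆ I' ∧
      TableOK P N' U' I' G T' := by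
  obtain ⟨as, ds, subs, hperm, hstep, hnew, rfl⟩ := hadd
  obtain ⟨hreg, hext⟩ := hN.registerNodes subset_rfl hnew.2.2.1
    fun u hu hmem => (hnew.2.2.2 u hu).2.1 (hU hmem)
  refine ⟨_, _, I ∪ {i | ∃ t ∈ subs, i = t.id}, hreg, hext,
    Set.union_subset_union_right _ Set.subset_union_right, Set.subset_union_left, ?_⟩
  obtain ⟨G', hserve, hans⟩ := hr
  -- The identifier links the response to the node: `G'` and `B` have the same instances, so answers
  -- derivable for `G'` are derivable for `B`.
  obtain ⟨B, Bs, hbody, hB⟩ := hserve.body t.clause (hid ▸ ht)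
  have hm := h.mono hext
  refine ⟨hm.hr, hm.lr, hm.ans, fun u hu => ?_, fun u hu => ?_, fun u hu => ?_, ?_⟩
  · rcases List.mem_append.1 hu with hu | hu
    · exact hm.mem u hu
    · exact Or.inr ⟨u, hu, rfl⟩
  · rcases List.mem_append.1 hu with hu | hu
    · exact hm.derivable u hu
    · obtain ⟨H, hH, hs⟩ := exists_of_forall₂_of_mem hstep (hnew.clause_mem hu)
      exact hs.derivable hder hbody ((hans H (hperm.mem_iff.1 hH)).congr hB.symm)
  · rcases List.mem_append.1 hu with hu | hu
    · exact hm.answer u hu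
    · intro hs
      rw [(hnew.2.2.2 u hu).1] at hs
      cases hs
  · rintro i (hi | ⟨u, hu, rfl⟩)
    · rcases h.ids hi with hi | ⟨u, hu, rfl⟩
      · exact Or.inl hi
      · exact Or.inr ⟨u, List.mem_append_left _ hu, rfl⟩
    · exact Or.inr ⟨u, List.mem_append_right _ hu, rfl⟩

/-- Only the body part of `Serves` is assumed, because the identifier of the initial request is not
yet in use; it enters `U` together with the root. -/
theorem CreateTable.tableOK (hN : Registry N U) {pol : Set (Clause Const Pred)} (hpol : pol ⊆ P)
    {used : Set Ident} (hU : U ⊆ used) {a : Const} {r : Request Const Pred} {b : Bool}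
    (hr : ∀ c, (r.id, c) ∈ N →
      ∃ B Bs, c.body = B :: Bs ∧ insts (⟨B, []⟩ : Clause Const Pred) = insts ⟨r.goal, []⟩)
    (hcreate : CreateTable pol used a r T' ms b) :
    ∃ N' U' I', Registry N' U' ∧ Extends N U N' U' ∧ U' ⊆ U ∪ I' ∧
      TableOK P N' U' I' r.goal T' ∧ ∀ m ∈ ms, MessageOK P N' U' m := by
  obtain ⟨T, ⟨hhr, hlr, -, hans, hroot, cs, ds, -, hcs, hstep, hnew⟩, hact⟩ := hcreate
  obtain ⟨hreg, hext⟩ := hN.registerNodes (Set.subset_insert r.id U) hnew.2.2.1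
    fun u hu hmem => (hnew.2.2.2 u hu).2.1 (by
      rcases hmem with h | h
      · exact Or.inr h
      · exact Or.inl (hU h))
  have hids : T.ids = insert r.id {i | ∃ t ∈ T.nodes, i = t.id} := by
    ext
    simp [Table.ids, hroot]
  refine ⟨_, _, T.ids, hreg, hext, ?_, TableOK.activateNode hreg hact ?_⟩
  · rw [hids]
    rintro i ((hi | hi) | hi)
    · exact Or.inr (Or.inl hi)
    · exact Or.inl hi
    · exact Or.inr (Or.inr hi)
  · refine ⟨fun r' hr' => ?_, by simp [hlr], by simp [hans], fun u hu => Or.inr ⟨u, hu, rfl⟩,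
      fun u hu => ?_, fun u hu hs => ?_, subset_rfl⟩
    · obtain rfl : r = r' := Option.some.inj (hhr.symm.trans hr')
      refine ⟨Or.inl (Or.inl rfl), fun c hc => ?_⟩
      rcases hc with hc | ⟨u, hu, e⟩
      · exact hr c hc
      -- New children avoid the identifier of the request as well.
      · exact absurd (Or.inr (congrArg Prod.fst e).symm) (hnew.2.2.2 u hu).2.1
    · obtain ⟨c, hc, hs⟩ := exists_of_forall₂_of_mem hstep (hnew.clause_mem hu)
      exact hs.derivable (hpol ((hcs c).1 hc).1)
    · rw [(hnew.2.2.2 u hu).1] at hs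
      cases hs

/-! ## Preservation of the invariant -/

/-- The tables and the messages in transit agree with a registry. -/
structure Consistent (P : Set (Clause Const Pred)) (N : Set (Ident × Clause Const Pred))
    (U : Set Ident) (tab : Tables Const Pred) (net : Multiset (Message Const Pred)) : Prop where
  registry : Registry N U
  used : U ⊆ usedIds tab
  tables : ∀ G T, tab G = some T → TableOK P N U ∅ G T
  net : ∀ m ∈ net, MessageOK P N U m

variable {tab : Tables Const Pred} {net : Multiset (Message Const Pred)}

-- Replacing a table must not free identifiers: those of the old table lie in `I`, which the new
-- table retains, so `U'` stays within the identifiers that the algorithm regards as used.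
open scoped Classical in
theorem Consistent.update (hC : Consistent P N U tab net) (hN : Registry N' U')
    (hext : Extends N U N' U') (hU : U' ⊆ U ∪ I) (hI : ∀ T, tab G = some T → T.ids ⊆ I)
    (hT : TableOK P N' U' I G T') (hms : ∀ m ∈ ms, MessageOK P N' U' m) :
    Consistent P N' U' (Function.update tab G (some T')) (ms + net) := by
  refine ⟨hN, fun i hi => ?_, fun G₀ T₀ h₀ => ?_, fun m hm => ?_⟩
  · have hIT : ∀ i ∈ I, i ∈ usedIds (Function.update tab G (some T')) :=
      fun i hi => ⟨G, T', by simp, hT.ids hi⟩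
    rcases hU hi with hi | hi
    · obtain ⟨G₀, T₀, h₀, hi⟩ := hC.used hi
      by_cases hG : G₀ = G
      · subst hG
        exact hIT i (hI T₀ h₀ hi)
      · exact ⟨G₀, T₀, by simpa [hG] using h₀, hi⟩
    · exact hIT i hi
  · by_cases hG : G₀ = G
    · subst hG
      obtain rfl : T' = T₀ := by simpa using h₀
      exact { hT with ids := Set.empty_subset _ }
    · exact (hC.tables G₀ T₀ (by simpa [hG] using h₀)).mono hext
  · rcases Multiset.mem_add.1 hm with hm | hm
    · exact hms m hm
    · exact (hC.net m hm).mono hext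

theorem Extends.refl (N : Set (Ident × Clause Const Pred)) (U : Set Ident) : Extends N U N U :=
  ⟨subset_rfl, subset_rfl, fun _ _ h => Or.inl h⟩

open scoped Classical in
theorem Consistent.update_of_same (hC : Consistent P N U tab net) (hT : tab G = some T)
    (hT' : TableOK P N U T.ids G T') (hms : ∀ m ∈ ms, MessageOK P N U m) :
    Consistent P N U (Function.update tab G (some T')) (ms + net) :=
  hC.update hC.registry (.refl N U) Set.subset_union_left
    (fun T₀ h => by rw [Option.some.inj (hT.symm.trans h)]) hT' hms

open scoped Classical in
theorem Consistent.processRequest (hC : Consistent P N U tab net)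
    {pol : Set (Clause Const Pred)} (hpol : pol ⊆ P) {a : Const} {r : Request Const Pred}
    {b : Bool} (hmem : (∃ G T, tab G = some T) → r.id ∈ U)
    (hr : ∀ c, (r.id, c) ∈ N →
      ∃ B Bs, c.body = B :: Bs ∧ insts (⟨B, []⟩ : Clause Const Pred) = insts ⟨r.goal, []⟩)
    (hproc : ProcessRequest pol tab a r G T' ms b) :
    ∃ N' U', Consistent P N' U' (Function.update tab G (some T')) (ms + net) := by
  cases hproc with
  | @disposed _ T hT hvar _ x hx =>
    subst hx
    have hs : Serves N U r.id G := Serves.congr ⟨hmem ⟨_, _, hT⟩, hr⟩ hvar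
    obtain ⟨h1, h2⟩ := (hC.tables _ _ hT).with_ids.sendResponse (r := { r with goal := G }) hs
      .disposed ∅
    exact ⟨N, U, hC.update_of_same hT h1
      fun m hm => by obtain rfl := Multiset.mem_singleton.1 hm; exact h2⟩
  | @lower _ T hT hvar _ r₁ _ _ x hx =>
    subst hx
    have hs : Serves N U r.id G := Serves.congr ⟨hmem ⟨_, _, hT⟩, hr⟩ hvar
    have h := (hC.tables _ _ hT).with_ids
    have h' : TableOK P N U T.ids G { T with lr := T.lr ++ [{ r with goal := G }] } :=
      { h with
        lr := fun r' hr' => by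
          rcases List.mem_append.1 hr' with hr' | hr'
          · exact h.lr r' hr'
          · obtain rfl := List.mem_singleton.1 hr'
            exact hs
        ids := subset_rfl }
    obtain ⟨h1, h2⟩ := h'.sendResponse (r := { r with goal := G }) hs .active {r₁.id}
    exact ⟨N, U, hC.update_of_same hT h1
      fun m hm => by obtain rfl := Multiset.mem_singleton.1 hm; exact h2⟩
  | side hT _ _ _ _ _ hvar hnone hc =>
    obtain ⟨N', U', I, h1, h2, h3, h4, h5⟩ := hc.tableOK hC.registry hpol hC.used
      (fun c hc => by
        change ∃ B Bs, _ ∧ _ = insts ⟨G, []⟩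
        rw [hvar.clause.insts_eq]
        exact hr c hc)
    exact ⟨N', U', hC.update h1 h2 h3 (fun T h => by simp [hnone] at h) h4 h5⟩
  | fresh hnone hc =>
    obtain ⟨N', U', I, h1, h2, h3, h4, h5⟩ := hc.tableOK hC.registry hpol hC.used hr
    refine ⟨N', U', hC.update h1 h2 h3 (fun T h => ?_) h4 h5⟩
    -- The goal is a variant of itself, so no table is overwritten.
    rw [hnone _ ⟨Equiv.refl ℕ, r.goal.bind_var.symm⟩] at h
    cases h

open scoped Classical in
theorem Consistent.processResponse (hC : Consistent P N U tab net) (hT : tab G = some T)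
    {a : Const} {r : Response Const Pred} (hr : MessageOK P N U (.response a r))
    {t : Node Const Pred} (ht : t ∈ T.nodes) (hid : t.id = r.id) {b : Bool}
    (hproc : ProcessResponse (usedIds tab) a G r t T T' ms b) :
    ∃ N' U', Consistent P N' U' (Function.update tab G (some T')) (ms + net) := by
  have h := (hC.tables _ _ hT).with_ids
  have hadds : ∀ {T₁ : Table Const Pred}, AddAnswers (usedIds tab) r t (updateStatus r t T) T₁ →
      ∃ N' U' I', Registry N' U' ∧ Extends N U N' U' ∧ U' ⊆ U ∪ I' ∧ T.ids ⊆ I' ∧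
        TableOK P N' U' I' G T₁ := fun hadd =>
    (h.updateStatus r t).addAnswers hC.registry hC.used hr (h.mem t ht) (h.derivable t ht) hid
      hadd
  cases hproc with
  | ignore =>
    exact ⟨N, U, hC.update_of_same hT h fun m hm => absurd hm (Multiset.notMem_zero m)⟩
  | wait _ hadd =>
    obtain ⟨N', U', I', h1, h2, h3, h4, h5⟩ := hadds hadd
    exact ⟨N', U', hC.update h1 h2 h3
      (fun T₀ h => by rwa [← Option.some.inj (hT.symm.trans h)]) h5
      fun m hm => absurd hm (Multiset.notMem_zero m)⟩
  | resume _ hadd _ hact =>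
    obtain ⟨N', U', I', h1, h2, h3, h4, h5⟩ := hadds hadd
    obtain ⟨h6, h7⟩ := TableOK.activateNode h1 hact h5
    exact ⟨N', U', hC.update h1 h2 h3
      (fun T₀ h => by rwa [← Option.some.inj (hT.symm.trans h)]) h6 h7⟩

theorem localPolicy_subset {n : ℕ} (principal : Fin n ↪ Const)
    (P : Fin n → Finset (Clause Const Pred)) (a : Const) :
    localPolicy principal P a ⊆ globalPolicy P :=
  fun _ ⟨i, _, hc⟩ => ⟨i, hc⟩

theorem Consistent.step {n : ℕ} {principal : Fin n ↪ Const}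
    {P : Fin n → Finset (Clause Const Pred)} {s s' : State Const Pred}
    (hC : Consistent (globalPolicy P) N U s.tables s.net) (hstep : Step principal P s s') :
    ∃ N' U', Consistent (globalPolicy P) N' U' s'.tables s'.net := by
  cases hstep with
  | @request net r a G T' ms h _ hnet _ hproc =>
    have hr : Serves N U r.id r.goal :=
      hC.net (.request r) (by rw [hnet]; exact Multiset.mem_cons_self _ _)
    have hC' : Consistent (globalPolicy P) N U s.tables net :=
      { hC with net := fun m hm => hC.net m (by rw [hnet]; exact Multiset.mem_cons_of_mem hm) }
    exact hC'.processRequest (localPolicy_subset principal P a) (fun _ => hr.mem) hr.body hproc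
  | @response net a r G T T' t ms h _ hnet _ hT ht hid hproc =>
    have hr : MessageOK (globalPolicy P) N U (.response a r) :=
      hC.net _ (by rw [hnet]; exact Multiset.mem_cons_self _ _)
    have hC' : Consistent (globalPolicy P) N U s.tables net :=
      { hC with net := fun m hm => hC.net m (by rw [hnet]; exact Multiset.mem_cons_of_mem hm) }
    exact hC'.processResponse hT hr ht hid hproc
  | @returned net a r _ hnet _ =>
    exact ⟨N, U, { hC with
      net := fun m hm => hC.net m (by rw [hnet]; exact Multiset.mem_cons_of_mem hm) }⟩

/-- The initial state has to be set apart: its request carries an identifier that no tree contains.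
The first step can only process this request, and does so with an empty registry, for which the
condition on bodies is vacuous. -/
theorem Reached.consistent {n : ℕ} {principal : Fin n ↪ Const}
    {P : Fin n → Finset (Clause Const Pred)} {r : Request Const Pred} {s : State Const Pred}
    (h : Reached principal P r s) :
    s = initState r ∨ ∃ N U, Consistent (globalPolicy P) N U s.tables s.net := by
  induction h with
  | refl => exact Or.inl rfl
  | tail _ hstep ih =>
    right
    rcases ih with rfl | ⟨N, U, hC⟩
    · cases hstep with
      | @request net r' a G T' ms h _ hnet _ hproc =>
        have hC : Consistent (globalPolicy P) ∅ ∅ (initState r).tables net := by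
          refine ⟨⟨fun _ _ _ h => h.elim, fun _ _ h => h.elim⟩, Set.empty_subset _,
            fun _ _ h => (by cases h), fun m hm => ?_⟩
          have := congrArg Multiset.card hnet
          obtain rfl : net = 0 := by simpa [initState] using this
          exact absurd hm (Multiset.notMem_zero m)
        exact hC.processRequest (localPolicy_subset principal P a)
          (fun ⟨_, _, h⟩ => by cases h) (fun _ h => h.elim) hproc
      | response _ _ _ hT => cases hT
      | @returned net a r' _ hnet =>
        have : Message.response a r' ∈ (initState r).net := by
          rw [hnet]; exact Multiset.mem_cons_self _ _
        cases Multiset.mem_singleton.1 this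
    · exact hC.step hstep

theorem TableOK.derivable_of_hasAnswer (h : TableOK P N U I G T) {H : Atom Const Pred}
    (hH : T.HasAnswer H) : Derivable P G (insts ⟨H, []⟩) := by
  rcases hH with ⟨p, hp, rfl⟩ | ⟨t, ht, hs, rfl⟩
  · exact h.ans p hp
  · rw [← h.answer t ht hs]
    exact h.derivable t ht

end GEM

theorem theorem1 {Const Pred : Type*} {n : ℕ} (principal : Fin n ↪ Const)
    (P : Fin n → Finset (GEM.Clause Const Pred)) (G₁ : GEM.Atom Const Pred)
    (id₀ : GEM.Ident) (req : Const) (S : GEM.State Const Pred)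
    (hS : GEM.Reached principal P ⟨id₀, req, G₁⟩ S)
    (G : GEM.Atom Const Pred) (T : GEM.Table Const Pred) (hT : S.tables G = some T) :
    (∀ H, T.HasAnswer H → ∃ θ : GEM.Subst Const, H = G.subst θ) ∧
    ∀ θ ∈ GEM.solutions G T, ∃ σ : GEM.Subst Const,
      GEM.IsCAS (GEM.globalPolicy P) [G] σ ∧ (G.subst σ).Variant (G.subst θ) := by
  rcases hS.consistent with rfl | ⟨N, U, hC⟩
  · cases hT
  have h := hC.tables G T hT
  exact ⟨fun H hH => (h.derivable_of_hasAnswer hH).exists_subst,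
    fun θ hθ => (h.derivable_of_hasAnswer hθ).exists_isCAS⟩
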